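/- Let $d\ge 1$, let $\Omega\subset\mathbb{R}^d$ be a bounded domain with smooth boundary, let $T>0$, and set $Q:=\Omega\times(0,T)$, $\Sigma:=\partial\Omega\times(0,T)$. Let $c_0\in(\tfrac{1}{\sqrt2},1)$ and let $H\in C([0,T];\mathbb{R}^d)$. Assume that there are $T_1'\in(0,T]$ and $\rho>0$ such that $H\in C^1([0,T_1'];\mathbb{R}^d)$ and $\min_{t\in[0,T_1']}|H(t)|\ge\rho$. Define $$t_1':=\sup\Big\{\tau\in[0,T_1'] \ \Big|\ \frac{H(t)}{|H(t)|}\cdot\frac{H(0)}{|H(0)|}\ge c_0\ \text{ for all } t\in[0,\tau]\Big\}.$$ Suppose that there is a point $x_0\in\mathbb{R}^d\setminus\overline{\Omega}$ such that $$\min_{(x,t)\in\overline{\Omega}\times[0,t_1']}\frac{H(t)\cdot(x-x_0)}{|H(t)||x-x_0|}\ge 2c_0^2-1$$ and such that $T_0'<t_1'$, where $$T_0':=\frac{\max_{x\in\overline{\Omega}}|x-x_0|^2-\min_{x\in\overline{\Omega}}|x-x_0|^2}{\delta},\qquad \delta:=\rho\,(2c_0^2-1)\,\mathrm{dist}(x_0,\Omega)>0.$$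 Then there exists a constant $C>0$ such that for every $g\in L^2(\Sigma)$, every $u\in H^1(Q)$ satisfying $$\partial_t u+H(t)\cdot\nabla u=0\ \text{ in } Q,\qquad u=g\ \text{ on } \Sigma \text{ (in the sense of traces)},$$ and every $t\in[0,T]$, $$\|u(\cdot,t)\|_{L^2(\Omega)}\le C\,\|g\|_{L^2(\Sigma)},$$ where $u(\cdot,t)\in L^2(\Omega)$ is the trace of $u$ on $\Omega\times\{t\}$. The constant $C$ does not depend on $g$, $u$ or $t$. -/

import Mathlib

open MeasureTheory Filter Topology Set
open scoped ContDiff ENNReal RealInnerProductSpace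

noncomputable section

namespace Transport

/-- A bounded domain (nonempty, open, connected, bounded) with smooth boundary: near each boundary
point, `Ω` is the sublevel set `{ρ < 0}` of a smooth function `ρ` with non-vanishing differential
at that point (so `Ω` lies locally on one side of the smooth hypersurface `∂Ω`). -/
structure IsSmoothBoundedDomain {d : ℕ} (Ω : Set (EuclideanSpace ℝ (Fin d))) : Prop where
  isOpen : IsOpen Ω
  isConnected : IsConnected Ω
  isBounded : Bornology.IsBounded Ω
  smooth_boundary : ∀ x ∈ frontier Ω, ∃ U ∈ 𝓝 x, ∃ ρ : EuclideanSpace ℝ (Fin d) → ℝ,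
    ContDiff ℝ ∞ ρ ∧ fderiv ℝ ρ x ≠ 0 ∧ ∀ y ∈ U, (y ∈ Ω ↔ ρ y < 0)

/-- The space-time cylinder `Q = Ω × (0, T)`. -/
def cylinder {d : ℕ} (Ω : Set (EuclideanSpace ℝ (Fin d))) (T : ℝ) :
    Set (EuclideanSpace ℝ (Fin d) × ℝ) :=
  Ω ×ˢ Ioo 0 T

/-- The measure `dσ dt` of the lateral boundary `Σ = ∂Ω × (0, T)`, where `dσ` is the surface
measure of `∂Ω`, i.e. the `(d - 1)`-dimensional Hausdorff measure (normalized as Lebesgue measure)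
restricted to `∂Ω`. -/
def lateralMeasure {d : ℕ} (Ω : Set (EuclideanSpace ℝ (Fin d))) (T : ℝ) :
    Measure (EuclideanSpace ℝ (Fin d) × ℝ) :=
  ((μHE[d - 1] : Measure (EuclideanSpace ℝ (Fin d))).restrict (frontier Ω)).prod
    ((volume : Measure ℝ).restrict (Ioo 0 T))

/-- `D` is the weak differential of `u` on the open set `Q` of space-time, `D ∈ L²(Q)`:
`∫_Q u ∂_v φ = - ∫_Q (D v) φ` for all test functions `φ ∈ C_c^∞(Q)` and all directions `v`.
Thus `D z (0, 1)` is the weak derivative `∂ₜu (z)`, and `D z (h, 0)` is `h · ∇u (z)`. -/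
def HasWeakDifferential {d : ℕ} (Q : Set (EuclideanSpace ℝ (Fin d) × ℝ))
    (u : EuclideanSpace ℝ (Fin d) × ℝ → ℝ)
    (D : EuclideanSpace ℝ (Fin d) × ℝ → (EuclideanSpace ℝ (Fin d) × ℝ) →L[ℝ] ℝ) : Prop :=
  MemLp D 2 (volume.restrict Q) ∧
  ∀ φ : EuclideanSpace ℝ (Fin d) × ℝ → ℝ,
    ContDiff ℝ ∞ φ → HasCompactSupport φ → tsupport φ ⊆ Q →
    ∀ v : EuclideanSpace ℝ (Fin d) × ℝ,
      ∫ z in Q, u z * fderiv ℝ φ z v = - ∫ z in Q, D z v * φ z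

/-- The Sobolev space `H¹(Q)`. -/
def MemH1 {d : ℕ} (Q : Set (EuclideanSpace ℝ (Fin d) × ℝ))
    (u : EuclideanSpace ℝ (Fin d) × ℝ → ℝ) : Prop :=
  MemLp u 2 (volume.restrict Q) ∧ ∃ D, HasWeakDifferential Q u D

/-- The functions `φ n` (smooth up to the boundary of the bounded set `Q`, being restrictions of
smooth functions on the whole space) converge to `u` in `H¹(Q)`. -/
def SmoothApproxH1 {d : ℕ} (Q : Set (EuclideanSpace ℝ (Fin d) × ℝ))
    (φ : ℕ → EuclideanSpace ℝ (Fin d) × ℝ → ℝ)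
    (u : EuclideanSpace ℝ (Fin d) × ℝ → ℝ) : Prop :=
  (∀ n, ContDiff ℝ ∞ (φ n)) ∧
  Tendsto (fun n => eLpNorm (fun z => φ n z - u z) 2 (volume.restrict Q)) atTop (𝓝 0) ∧
  ∃ D, HasWeakDifferential Q u D ∧
    Tendsto (fun n => eLpNorm (fun z => fderiv ℝ (φ n) z - D z) 2 (volume.restrict Q))
      atTop (𝓝 0)

/-- `g ∈ L²(Σ)` is the trace of `u ∈ H¹(Ω × (0, T))` on the lateral boundary `Σ = ∂Ω × (0, T)`:
the limit in `L²(Σ)` of the restrictions to `Σ` of functions smooth up to the boundary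
that converge to `u` in `H¹`. -/
def HasLateralTrace {d : ℕ} (Ω : Set (EuclideanSpace ℝ (Fin d))) (T : ℝ)
    (u g : EuclideanSpace ℝ (Fin d) × ℝ → ℝ) : Prop :=
  MemLp g 2 (lateralMeasure Ω T) ∧
  ∃ φ, SmoothApproxH1 (cylinder Ω T) φ u ∧
    Tendsto (fun n => eLpNorm (fun z => φ n z - g z) 2 (lateralMeasure Ω T)) atTop (𝓝 0)

/-- `w ∈ L²(Ω)` is the time slice `u(·, t)` of `u ∈ H¹(Ω × (0, T))`, i.e. its trace on
`Ω × {t}`. -/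
def HasTimeSlice {d : ℕ} (Ω : Set (EuclideanSpace ℝ (Fin d))) (T : ℝ)
    (u : EuclideanSpace ℝ (Fin d) × ℝ → ℝ) (t : ℝ) (w : EuclideanSpace ℝ (Fin d) → ℝ) : Prop :=
  MemLp w 2 (volume.restrict Ω) ∧
  ∃ φ, SmoothApproxH1 (cylinder Ω T) φ u ∧
    Tendsto (fun n => eLpNorm (fun x => φ n (x, t) - w x) 2 (volume.restrict Ω)) atTop (𝓝 0)

/-- `u ∈ H¹(Q)` satisfies `∂ₜu + H(t) · ∇u = 0` in `Q = Ω × (0, T)` and `u = g` on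
`Σ = ∂Ω × (0, T)`. -/
structure IsSolution {d : ℕ} (Ω : Set (EuclideanSpace ℝ (Fin d))) (T : ℝ)
    (H : ℝ → EuclideanSpace ℝ (Fin d)) (g u : EuclideanSpace ℝ (Fin d) × ℝ → ℝ) : Prop where
  memH1 : MemH1 (cylinder Ω T) u
  equation : ∀ D, HasWeakDifferential (cylinder Ω T) u D →
    ∀ᵐ z ∂(volume.restrict (cylinder Ω T)), D z (0, 1) + D z (H z.2, 0) = 0
  boundary : HasLateralTrace Ω T u g

/-- `t₁' = sup {τ ∈ [0, T₁'] | H(t)/|H(t)| · H(0)/|H(0)| ≥ c₀ for all t ∈ [0, τ]}`. -/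
def angleTime {d : ℕ} (H : ℝ → EuclideanSpace ℝ (Fin d)) (c₀ T₁ : ℝ) : ℝ :=
  sSup {τ : ℝ | τ ∈ Icc 0 T₁ ∧ ∀ t ∈ Icc 0 τ, c₀ ≤ ⟪‖H t‖⁻¹ • H t, ‖H 0‖⁻¹ • H 0⟫}

/-- `δ = ρ (2 c₀² - 1) dist(x₀, Ω)`. -/
def deltaConst {d : ℕ} (Ω : Set (EuclideanSpace ℝ (Fin d))) (ρ c₀ : ℝ)
    (x₀ : EuclideanSpace ℝ (Fin d)) : ℝ :=
  ρ * (2 * c₀ ^ 2 - 1) * Metric.infDist x₀ Ω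

/-- `T₀' = (max_{x ∈ closure Ω} |x - x₀|² - min_{x ∈ closure Ω} |x - x₀|²) / δ`. -/
def observationTime {d : ℕ} (Ω : Set (EuclideanSpace ℝ (Fin d))) (ρ c₀ : ℝ)
    (x₀ : EuclideanSpace ℝ (Fin d)) : ℝ :=
  (sSup ((fun x => ‖x - x₀‖ ^ 2) '' closure Ω) - sInf ((fun x => ‖x - x₀‖ ^ 2) '' closure Ω)) /
    deltaConst Ω ρ c₀ x₀

end Transport

end

/-! The proof is a multiplier argument. Write `E(t) = ∫_Ω u(·,t)²`. Multiplying the equation by `2u`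
shows that `E` changes only through the flux across `Σ`, so all values of `E` agree up to a boundary
term. Multiplying by `2wu` with `w(x) = |x - x₀|² - m`, where `m` is the minimum of `|x - x₀|²` on
the closure of `Ω`, produces the source `u² H·∇w = 2u² H·(x - x₀) ≥ 2δu²` up to time `τ = t₁'`.
Since `0 ≤ w ≤ W` on the closure, with `W` the oscillation of `|x - x₀|²`, the weighted energy at
time `τ` is at least about `2δτ E(τ)` and at most `W E(τ)`. As `2δτ > W`, the boundary term controls
`E(τ)`, hence every `E(t)`.

The flux is bounded by an inequality, not computed by the divergence theorem:
`enorm_setIntegral_partial_le` integrates along lines parallel to an axis, counts boundary points on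
each line, and sums the counts with Eilenberg's inequality `lintegral_tsum_fiber_le`.

The estimate `exists_energy_le` is proved for `C¹` functions that need not solve the equation, with
the residual `∂ₜφ + H·∇φ` kept on the right. The residual tends to zero along smooth approximations
of an `H¹` solution, which gives `eLpNorm_timeSlice_le`. -/

namespace Transport

/-! ### Integrals of derivatives over open subsets of the line -/

/-- The maximal open intervals contained in a bounded open subset of the line. -/
theorem exists_gap_of_mem {U : Set ℝ} (hU : IsOpen U) (hb : Bornology.IsBounded U) {x : ℝ}
    (hx : x ∈ U) : ∃ a b, a < x ∧ x < b ∧ Ioo a b ⊆ U ∧ a ∉ U ∧ b ∉ U := by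
  obtain ⟨R, hR⟩ := hb.subset_closedBall 0
  have hR' : ∀ y ∈ U, |y| ≤ R := fun y hy => by simpa using hR hy
  have hcl : IsClosed Uᶜ := hU.isClosed_compl
  have hout : ∀ y, R < |y| → y ∈ Uᶜ := fun y hy h => absurd (hR' y h) (not_le.2 hy)
  have hA : (Uᶜ ∩ Iic x).Nonempty :=
    ⟨-(R + 1 + |x|), hout _ (by
      have := abs_nonneg x; have := (abs_nonneg x).trans (hR' x hx)
      rw [abs_neg, abs_of_nonneg] <;> linarith), by
      have := neg_abs_le x; have := (abs_nonneg x).trans (hR' x hx)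
      simp only [mem_Iic]; linarith⟩
  have hB : (Uᶜ ∩ Ici x).Nonempty :=
    ⟨R + 1 + |x|, hout _ (by
      have := abs_nonneg x; have := (abs_nonneg x).trans (hR' x hx)
      rw [abs_of_nonneg] <;> linarith), by
      have := le_abs_self x; have := (abs_nonneg x).trans (hR' x hx)
      simp only [mem_Ici]; linarith⟩
  have hAb : BddAbove (Uᶜ ∩ Iic x) := ⟨x, fun y hy => hy.2⟩
  have hBb : BddBelow (Uᶜ ∩ Ici x) := ⟨x, fun y hy => hy.2⟩
  have ha := (hcl.inter isClosed_Iic).csSup_mem hA hAb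
  have hbm := (hcl.inter isClosed_Ici).csInf_mem hB hBb
  refine ⟨_, _, lt_of_le_of_ne ha.2 (ne_of_mem_of_not_mem hx ha.1).symm,
    lt_of_le_of_ne hbm.2 (ne_of_mem_of_not_mem hx hbm.1), fun y hy => ?_, ha.1, hbm.1⟩
  by_contra hyU
  rcases le_total y x with h | h
  · exact absurd (le_csSup hAb ⟨hyU, h⟩) (not_le.2 hy.1)
  · exact absurd (csInf_le hBb ⟨hyU, h⟩) (not_le.2 hy.2)

/-- `U` is the disjoint union of countably many gaps, and on each the integral is a difference of
endpoint values. A frontier point is the left end of at most one gap and the right end of at most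
one, whence the factor 2. -/
theorem enorm_integral_deriv_le_tsum_frontier {U : Set ℝ} (hU : IsOpen U)
    (hb : Bornology.IsBounded U) {f f' : ℝ → ℝ} (hf : ∀ x, HasDerivAt f (f' x) x)
    (hf' : Continuous f') :
    ‖∫ x in U, f' x‖ₑ ≤ 2 * ∑' z : frontier U, ‖f z‖ₑ := by
  let S : Set (ℝ × ℝ) := {p | p.1 < p.2 ∧ Ioo p.1 p.2 ⊆ U ∧ p.1 ∉ U ∧ p.2 ∉ U}
  have hdisj : S.PairwiseDisjoint (fun p => Ioo p.1 p.2) := by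
    intro p hp q hq hpq
    by_contra hnd
    obtain ⟨x, hxp, hxq⟩ := Set.not_disjoint_iff.1 hnd
    apply hpq
    have h1 : p.1 ≤ q.1 := le_of_not_gt fun h => hp.2.2.1 (hq.2.1 ⟨h, hxp.1.trans hxq.2⟩)
    have h2 : q.1 ≤ p.1 := le_of_not_gt fun h => hq.2.2.1 (hp.2.1 ⟨h, hxq.1.trans hxp.2⟩)
    have h3 : p.2 ≤ q.2 := le_of_not_gt fun h => hq.2.2.2 (hp.2.1 ⟨hxp.1.trans hxq.2, h⟩)
    have h4 : q.2 ≤ p.2 := le_of_not_gt fun h => hp.2.2.2 (hq.2.1 ⟨hxq.1.trans hxp.2, h⟩)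
    exact Prod.ext (le_antisymm h1 h2) (le_antisymm h3 h4)
  have hcount : S.Countable :=
    hdisj.countable_of_isOpen (fun _ _ => isOpen_Ioo) fun p hp => nonempty_Ioo.2 hp.1
  have : Countable S := hcount
  have hUnion : U = ⋃ p : S, Ioo p.1.1 p.1.2 := by
    ext x
    simp only [mem_iUnion]
    constructor
    · intro hx
      obtain ⟨a, b, h1, h2, h3, h4, h5⟩ := exists_gap_of_mem hU hb hx
      exact ⟨⟨(a, b), h1.trans h2, h3, h4, h5⟩, h1, h2⟩
    · rintro ⟨p, hp⟩
      exact p.2.2.1 hp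
  have hint : IntegrableOn f' U := by
    obtain ⟨R, hR⟩ := hb.subset_closedBall 0
    exact (hf'.continuousOn.integrableOn_compact (isCompact_closedBall 0 R)).mono_set hR
  have hsum := hasSum_integral_iUnion (μ := volume) (f := f')
    (s := fun p : S => Ioo p.1.1 p.1.2) (fun _ => measurableSet_Ioo)
    (fun p q hpq => hdisj p.2 q.2 (fun h => hpq (Subtype.ext h))) (hUnion ▸ hint)
  rw [← hUnion] at hsum
  have hval : ∀ p : S, ∫ x in Ioo p.1.1 p.1.2, f' x = f p.1.2 - f p.1.1 := fun p => by
    rw [← integral_Ioc_eq_integral_Ioo, ← intervalIntegral.integral_of_le p.2.1.le]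
    exact intervalIntegral.integral_eq_sub_of_hasDerivAt (fun x _ => hf x)
      (hf'.intervalIntegrable _ _)
  have hfr : ∀ p : S, p.1.1 ∈ frontier U ∧ p.1.2 ∈ frontier U := fun p => by
    have hc : Icc p.1.1 p.1.2 ⊆ closure U := by
      rw [← closure_Ioo p.2.1.ne]; exact closure_mono p.2.2.1
    rw [hU.frontier_eq]
    exact ⟨⟨hc (left_mem_Icc.2 p.2.1.le), p.2.2.2.1⟩, ⟨hc (right_mem_Icc.2 p.2.1.le), p.2.2.2.2⟩⟩
  have hinj1 : Function.Injective (fun p : S => (⟨p.1.1, (hfr p).1⟩ : frontier U)) := by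
    intro p q h
    have h' : p.1.1 = q.1.1 := congrArg Subtype.val h
    by_contra hne
    have := hdisj p.2 q.2 (fun h => hne (Subtype.ext h))
    rw [Function.onFun, Set.disjoint_left] at this
    obtain ⟨x, hx1, hx2⟩ := exists_between (lt_min p.2.1 (h' ▸ q.2.1 : p.1.1 < q.1.2))
    exact this ⟨hx1, (lt_min_iff.1 hx2).1⟩ ⟨h' ▸ hx1, (lt_min_iff.1 hx2).2⟩
  have hinj2 : Function.Injective (fun p : S => (⟨p.1.2, (hfr p).2⟩ : frontier U)) := by
    intro p q h
    have h' : p.1.2 = q.1.2 := congrArg Subtype.val h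
    by_contra hne
    have := hdisj p.2 q.2 (fun h => hne (Subtype.ext h))
    rw [Function.onFun, Set.disjoint_left] at this
    obtain ⟨x, hx1, hx2⟩ := exists_between (max_lt p.2.1 (h' ▸ q.2.1 : q.1.1 < p.1.2))
    exact this ⟨(max_lt_iff.1 hx1).1, hx2⟩ ⟨(max_lt_iff.1 hx1).2, h' ▸ hx2⟩
  rw [← hsum.tsum_eq]
  calc ‖∑' p : S, ∫ x in Ioo p.1.1 p.1.2, f' x‖ₑ
      ≤ ∑' p : S, ‖∫ x in Ioo p.1.1 p.1.2, f' x‖ₑ := enorm_tsum_le_tsum_enorm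
    _ ≤ ∑' p : S, (‖f p.1.2‖ₑ + ‖f p.1.1‖ₑ) :=
        ENNReal.tsum_le_tsum fun p => by rw [hval]; exact enorm_sub_le
    _ = ∑' p : S, ‖f p.1.2‖ₑ + ∑' p : S, ‖f p.1.1‖ₑ := ENNReal.tsum_add
    _ ≤ ∑' z : frontier U, ‖f z‖ₑ + ∑' z : frontier U, ‖f z‖ₑ :=
        add_le_add (ENNReal.tsum_comp_le_tsum_of_injective hinj2 fun z : frontier U => ‖f z‖ₑ)
          (ENNReal.tsum_comp_le_tsum_of_injective hinj1 fun z : frontier U => ‖f z‖ₑ)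
    _ = 2 * ∑' z : frontier U, ‖f z‖ₑ := (two_mul _).symm

/-! ### Counting points in fibres -/

/-- The level sets of `q` form a countable measurable partition into small pieces: `q x` is the
first index of a dense sequence that comes within `ε / 2` of `x`. -/
theorem exists_measurable_nat_dist_lt (X : Type*) [PseudoMetricSpace X] [MeasurableSpace X]
    [OpensMeasurableSpace X] [TopologicalSpace.SeparableSpace X] [Nonempty X] {ε : ℝ} (hε : 0 < ε) :
    ∃ q : X → ℕ, Measurable q ∧ ∀ x z, q x = q z → dist x z < ε := by
  classical
  have hex : ∀ x : X, ∃ k, dist x (TopologicalSpace.denseSeq X k) < ε / 2 := fun x =>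
    (TopologicalSpace.denseRange_denseSeq X).exists_dist_lt x (half_pos hε)
  refine ⟨fun x => Nat.find (hex x), measurable_find hex fun k =>
    (isOpen_lt (by fun_prop) (by fun_prop)).measurableSet, fun x z h => ?_⟩
  have h1 := Nat.find_spec (hex x)
  have h2 := Nat.find_spec (hex z)
  have h' : Nat.find (hex x) = Nat.find (hex z) := h
  rw [h'] at h1
  calc dist x z ≤ _ := dist_triangle_right _ _ _
    _ < ε / 2 + ε / 2 := add_lt_add h1 h2
    _ = ε := add_halves ε

/-- Eilenberg's inequality for the counting function of the fibres. -/
theorem lintegral_tsum_fiber_le {X Y : Type*} [MetricSpace X] [MeasurableSpace X] [BorelSpace X]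
    [TopologicalSpace.SeparableSpace X] [MeasurableSpace Y] {μ : Measure X} {ν : Measure Y}
    {π : X → Y} (hπ : ∀ A, ν (π '' A) ≤ μ A) {K : Set X} (hK : MeasurableSet K)
    {h : X → ℝ≥0∞} (hh : Continuous h) :
    ∫⁻ y, ∑' z : ↥(π ⁻¹' {y} ∩ K), h z ∂ν ≤ ∫⁻ x in K, h x ∂μ := by
  rcases isEmpty_or_nonempty X with hX | hX
  · simp
  choose q hqm hq using fun n : ℕ =>
    exists_measurable_nat_dist_lt X (ε := 1 / ((n : ℝ) + 1)) (by positivity)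
  let A : ℕ → ℕ → Set X := fun n k => q n ⁻¹' {k} ∩ K
  have hA : ∀ n k, MeasurableSet (A n k) := fun n k => (hqm n (measurableSet_singleton k)).inter hK
  -- `g n` sums, over the pieces whose image has `y` in its measurable hull, the infimum of `h` on
  -- the piece. Its integral is at most that of `h`, and its liminf dominates the fibre sum as the
  -- pieces shrink; Fatou concludes. The hull is taken because `π '' A n k` need not be measurable.
  let c : ℕ → ℕ → ℝ≥0∞ := fun n k => ⨅ x ∈ A n k, h x
  let B : ℕ → ℕ → Set Y := fun n k => toMeasurable ν (π '' A n k)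
  let g : ℕ → Y → ℝ≥0∞ := fun n y => ∑' k, (B n k).indicator (fun _ => c n k) y
  have hg : ∀ n, Measurable (g n) := fun n => Measurable.tsum fun k =>
    measurable_const.indicator (measurableSet_toMeasurable _ _)
  have hgint : ∀ n, ∫⁻ y, g n y ∂ν ≤ ∫⁻ x in K, h x ∂μ := fun n => by
    rw [lintegral_tsum fun k =>
      (measurable_const.indicator (measurableSet_toMeasurable _ _)).aemeasurable]
    have hKU : K = ⋃ k, A n k := by ext x; simp [A]
    conv_rhs => rw [hKU, lintegral_iUnion (hA n) (fun i j hij =>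
      Set.disjoint_left.2 fun x hx hx' => hij (hx.1.symm.trans hx'.1))]
    refine ENNReal.tsum_le_tsum fun k => ?_
    rw [lintegral_indicator_const (measurableSet_toMeasurable _ _), measure_toMeasurable]
    calc c n k * ν (π '' A n k) ≤ c n k * μ (A n k) := by gcongr; exact hπ _
      _ = ∫⁻ _ in A n k, c n k ∂μ := by rw [setLIntegral_const]
      _ ≤ ∫⁻ x in A n k, h x ∂μ :=
        setLIntegral_mono' (hA n k) fun x hx => iInf₂_le x hx
  have hle : ∀ y, ∑' z : ↥(π ⁻¹' {y} ∩ K), h z ≤ liminf (fun n => g n y) atTop := fun y => by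
    rw [ENNReal.tsum_eq_iSup_sum]
    refine iSup_le fun F => ?_
    -- Finitely many distinct points eventually lie in distinct pieces, so each contributes its own
    -- term to `g n y`.
    have hsep : ∀ᶠ n in atTop, ∀ z ∈ F, ∀ z' ∈ F, q n z.1 = q n z'.1 → z = z' := by
      rw [Filter.eventually_all_finset]; intro z _
      rw [Filter.eventually_all_finset]; intro z' _
      by_cases hzz : z = z'
      · simp [hzz]
      · have hpos : 0 < dist z.1 z'.1 := dist_pos.2 fun h => hzz (Subtype.ext h)
        filter_upwards [tendsto_one_div_add_atTop_nhds_zero_nat.eventually (gt_mem_nhds hpos)]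
          with n hn heq
        exact absurd (hq n _ _ heq) (not_lt.2 hn.le)
    have hsum : ∀ᶠ n in atTop, ∑ z ∈ F, c n (q n z.1) ≤ g n y := by
      filter_upwards [hsep] with n hn
      have hmem : ∀ z ∈ F, y ∈ B n (q n z.1) := fun z _ =>
        subset_toMeasurable _ _ ⟨z.1, ⟨rfl, z.2.2⟩, z.2.1⟩
      calc ∑ z ∈ F, c n (q n z.1)
          = ∑ z ∈ F, (B n (q n z.1)).indicator (fun _ => c n (q n z.1)) y :=
            Finset.sum_congr rfl fun z hz => by rw [indicator_of_mem (hmem z hz)]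
        _ = ∑ k ∈ F.image (fun z => q n z.1), (B n k).indicator (fun _ => c n k) y := by
            rw [Finset.sum_image fun z hz z' hz' h => hn z hz z' hz' h]
        _ ≤ g n y := ENNReal.sum_le_tsum _
    have hc : ∀ z : ↥(π ⁻¹' {y} ∩ K), Tendsto (fun n => c n (q n z.1)) atTop (𝓝 (h z)) := fun z => by
      refine tendsto_order.2 ⟨fun b hb => ?_, fun b hb => Eventually.of_forall fun n =>
        (iInf₂_le z.1 ⟨rfl, z.2.2⟩ : c n (q n z.1) ≤ h z).trans_lt hb⟩
      obtain ⟨b', hbb', hb'⟩ := exists_between hb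
      obtain ⟨ε, hε, hball⟩ := Metric.mem_nhds_iff.1 ((hh.tendsto z.1).eventually (lt_mem_nhds hb'))
      filter_upwards [tendsto_one_div_add_atTop_nhds_zero_nat.eventually (gt_mem_nhds hε)] with n hn
      exact hbb'.trans_le
        (le_iInf₂ fun x hx => le_of_lt (hball ((hq n x z.1 hx.1).trans hn)))
    rw [← (tendsto_finsetSum F fun z _ => hc z).liminf_eq]
    exact liminf_le_liminf hsum
  calc _ ≤ ∫⁻ y, liminf (fun n => g n y) atTop ∂ν := lintegral_mono hle
    _ ≤ liminf (fun n => ∫⁻ y, g n y ∂ν) atTop := lintegral_liminf_le hg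
    _ ≤ _ := liminf_le_of_le (by isBoundedDefault) fun b hb => by
        obtain ⟨n, hn⟩ := hb.exists
        exact hn.trans (hgint n)

/-! ### A divergence inequality with Hausdorff measure on the frontier -/

/-- Dropping a coordinate is 1-Lipschitz, so it does not increase Hausdorff measure. The normalizing
constant depends only on the dimension `n` of the measure, so it is the same in both spaces. -/
theorem volume_image_succAbove_le {n : ℕ} (i : Fin (n + 1))
    (A : Set (EuclideanSpace ℝ (Fin (n + 1)))) :
    volume ((fun x : EuclideanSpace ℝ (Fin (n + 1)) => fun j => x (i.succAbove j)) '' A) ≤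
      μHE[n] A := by
  let P : EuclideanSpace ℝ (Fin (n + 1)) → EuclideanSpace ℝ (Fin n) :=
    fun x => WithLp.toLp 2 fun j => x (i.succAbove j)
  have hP : LipschitzWith 1 P := LipschitzWith.of_dist_le_mul fun x y => by
    rw [NNReal.coe_one, one_mul, EuclideanSpace.dist_eq, EuclideanSpace.dist_eq]
    refine Real.sqrt_le_sqrt ?_
    rw [Fin.sum_univ_succAbove _ i]
    exact le_add_of_nonneg_left (sq_nonneg _)
  have himg : (fun x : EuclideanSpace ℝ (Fin (n + 1)) => fun j => x (i.succAbove j)) '' A =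
      (MeasurableEquiv.toLp 2 (Fin n → ℝ)) ⁻¹' (P '' A) := by
    ext y
    simp only [mem_image, mem_preimage]
    constructor
    · rintro ⟨x, hx, rfl⟩; exact ⟨x, hx, rfl⟩
    · rintro ⟨x, hx, h⟩; exact ⟨x, hx, congrArg WithLp.ofLp h⟩
  have hmp : MeasurePreserving (MeasurableEquiv.toLp 2 (Fin n → ℝ)) volume volume :=
    PiLp.volume_preserving_toLp (Fin n)
  rw [himg, hmp.measure_preimage_equiv, ← EuclideanSpace.euclideanHausdorffMeasure_eq_volume,
    Measure.euclideanHausdorffMeasure_def, Measure.euclideanHausdorffMeasure_def,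
    Measure.smul_apply, Measure.smul_apply]
  have := hP.hausdorffMeasure_image_le (d := (n : ℝ)) (by positivity) A
  rw [ENNReal.coe_one, ENNReal.one_rpow, one_mul] at this
  gcongr

theorem integrableOn_of_isBounded {X : Type*} [MetricSpace X] [ProperSpace X]
    [MeasurableSpace X] [OpensMeasurableSpace X] {μ : Measure X} [IsFiniteMeasureOnCompacts μ]
    {E : Type*} [NormedAddCommGroup E] {f : X → E} (hf : Continuous f) {s : Set X}
    (hs : Bornology.IsBounded s) : IntegrableOn f s μ :=
  (hf.continuousOn.integrableOn_compact hs.isCompact_closure).mono_set subset_closure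

/-- A divergence inequality, valid on arbitrary bounded open sets. -/
theorem enorm_setIntegral_partial_le {n : ℕ} {Ω : Set (EuclideanSpace ℝ (Fin (n + 1)))}
    (hΩ : IsOpen Ω) (hb : Bornology.IsBounded Ω) (i : Fin (n + 1))
    {f : EuclideanSpace ℝ (Fin (n + 1)) → ℝ} (hf : ContDiff ℝ 1 f) :
    ‖∫ x in Ω, fderiv ℝ f x (EuclideanSpace.single i 1)‖ₑ ≤
      2 * ∫⁻ x in frontier Ω, ‖f x‖ₑ ∂μHE[n] := by
  let E := EuclideanSpace ℝ (Fin (n + 1))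
  let e : E := EuclideanSpace.single i 1
  -- Fubini coordinates: `s` runs along the `i`-th axis and `y` labels the line.
  let Ψ : ℝ × (Fin n → ℝ) ≃ᵐ E :=
    (MeasurableEquiv.piFinSuccAbove (fun _ => ℝ) i).symm.trans (MeasurableEquiv.toLp 2 _)
  have hΨ : MeasurePreserving Ψ volume volume :=
    (volume_preserving_piFinSuccAbove (fun _ : Fin (n + 1) => ℝ) i).symm.trans
      (PiLp.volume_preserving_toLp (Fin (n + 1)))
  have hΨval : ∀ s y, Ψ (s, y) = WithLp.toLp 2 (i.insertNth s y : Fin (n + 1) → ℝ) :=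
    fun _ _ => rfl
  have hline : ∀ s y, Ψ (s, y) = Ψ (0, y) + s • e := by
    intro s y
    rw [hΨval, hΨval]
    ext j
    refine Fin.succAboveCases i ?_ (fun k => ?_) j
    · change (i.insertNth s y : Fin (n + 1) → ℝ) i =
        (i.insertNth 0 y : Fin (n + 1) → ℝ) i + s * (EuclideanSpace.single i (1 : ℝ)) i
      simp
    · change (i.insertNth s y : Fin (n + 1) → ℝ) (i.succAbove k) =
        (i.insertNth 0 y : Fin (n + 1) → ℝ) (i.succAbove k) +
          s * (EuclideanSpace.single i (1 : ℝ)) (i.succAbove k)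
      simp
  have hlinecont : ∀ y, Continuous fun s => Ψ (s, y) := fun y => by
    have h : Continuous fun s : ℝ => Ψ (0, y) + s • e := by fun_prop
    exact h.congr fun s => (hline s y).symm
  have hder : ∀ y s, HasDerivAt (fun s => f (Ψ (s, y))) (fderiv ℝ f (Ψ (s, y)) e) s := by
    intro y s
    have h1 : HasDerivAt (fun s => Ψ (s, y)) e s := by
      have h := ((hasDerivAt_id s).smul_const e).const_add (Ψ (0, y))
      rw [one_smul] at h
      exact h.congr_of_eventuallyEq (Eventually.of_forall fun s => hline s y)
    exact ((hf.differentiable one_ne_zero _).hasFDerivAt).comp_hasDerivAt s h1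
  have hdc : Continuous fun x => fderiv ℝ f x e :=
    (hf.continuous_fderiv one_ne_zero).clm_apply continuous_const
  have hint : Integrable (Ω.indicator fun x => fderiv ℝ f x e) volume :=
    (integrable_indicator_iff hΩ.measurableSet).2 (integrableOn_of_isBounded hdc hb)
  let π : E → Fin n → ℝ := fun x j => x (i.succAbove j)
  have hπΨ : ∀ s y, π (Ψ (s, y)) = y := fun s y => by
    ext j; simp [π, hΨval]
  have hslice : ∀ y, ‖∫ s, Ω.indicator (fun x => fderiv ℝ f x e) (Ψ (s, y))‖ₑ ≤
      2 * ∑' z : ↥(π ⁻¹' {y} ∩ frontier Ω), ‖f z‖ₑ := by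
    intro y
    let U : Set ℝ := (fun s => Ψ (s, y)) ⁻¹' Ω
    have hU : IsOpen U := hΩ.preimage (hlinecont y)
    have hUb : Bornology.IsBounded U := by
      obtain ⟨R, hR⟩ := hb.subset_closedBall 0
      refine (Metric.isBounded_closedBall (x := (0 : ℝ)) (r := R)).subset fun s hs => ?_
      have h1 : ‖Ψ (s, y)‖ ≤ R := by simpa using hR hs
      have h2 := PiLp.norm_apply_le (Ψ (s, y)) i
      have h3 : (Ψ (s, y)) i = s := by simp [hΨval]
      rw [h3] at h2
      simpa using h2.trans h1
    have hrw : (fun s => Ω.indicator (fun x => fderiv ℝ f x e) (Ψ (s, y))) =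
        U.indicator fun s => fderiv ℝ f (Ψ (s, y)) e := by
      ext s; rfl
    rw [hrw, integral_indicator hU.measurableSet]
    refine (enorm_integral_deriv_le_tsum_frontier hU hUb (hder y)
      (hdc.comp (hlinecont y))).trans ?_
    gcongr
    -- Frontier points of the section map injectively into the frontier points of `Ω` on that line;
    -- an inclusion suffices, since only an upper bound is wanted.
    have hmem : ∀ z : frontier U, Ψ (z.1, y) ∈ π ⁻¹' {y} ∩ frontier Ω := fun z =>
      ⟨hπΨ _ _, (hlinecont y).frontier_preimage_subset Ω z.2⟩
    exact ENNReal.tsum_comp_le_tsum_of_injective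
      (f := fun z : frontier U => (⟨Ψ (z.1, y), hmem z⟩ : ↥(π ⁻¹' {y} ∩ frontier Ω)))
      (fun z z' h => Subtype.ext (congrArg Prod.fst (Ψ.injective (congrArg Subtype.val h))))
      (fun z => ‖f z‖ₑ)
  calc ‖∫ x in Ω, fderiv ℝ f x e‖ₑ
      = ‖∫ y, ∫ s, Ω.indicator (fun x => fderiv ℝ f x e) (Ψ (s, y))‖ₑ := by
        rw [← integral_indicator hΩ.measurableSet, ← hΨ.integral_comp Ψ.measurableEmbedding,
          Measure.volume_eq_prod, integral_prod_symm]
        exact (hΨ.integrable_comp_emb Ψ.measurableEmbedding).2 hint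
    _ ≤ ∫⁻ y, ‖∫ s, Ω.indicator (fun x => fderiv ℝ f x e) (Ψ (s, y))‖ₑ :=
        enorm_integral_le_lintegral_enorm _
    _ ≤ ∫⁻ y, 2 * ∑' z : ↥(π ⁻¹' {y} ∩ frontier Ω), ‖f z‖ₑ := lintegral_mono hslice
    _ = 2 * ∫⁻ y, ∑' z : ↥(π ⁻¹' {y} ∩ frontier Ω), ‖f z‖ₑ :=
        lintegral_const_mul' _ _ (by norm_num)
    _ ≤ 2 * ∫⁻ x in frontier Ω, ‖f x‖ₑ ∂μHE[n] := by
        gcongr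
        exact lintegral_tsum_fiber_le (volume_image_succAbove_le i)
          isClosed_frontier.measurableSet hf.continuous.enorm

theorem enorm_setIntegral_fderiv_le {d : ℕ} (hd : 1 ≤ d) {Ω : Set (EuclideanSpace ℝ (Fin d))}
    (hΩ : IsOpen Ω) (hb : Bornology.IsBounded Ω)
    {f : EuclideanSpace ℝ (Fin d) → ℝ} (hf : ContDiff ℝ 1 f) (v : EuclideanSpace ℝ (Fin d)) :
    ‖∫ x in Ω, fderiv ℝ f x v‖ₑ ≤
      2 * d * ‖v‖ₑ * ∫⁻ x in frontier Ω, ‖f x‖ₑ ∂μHE[d - 1] := by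
  obtain ⟨n, rfl⟩ := Nat.exists_eq_add_of_le' hd
  have hv : v = ∑ i, v i • EuclideanSpace.single i (1 : ℝ) := by
    simpa using ((EuclideanSpace.basisFun (Fin (n + 1)) ℝ).sum_repr v).symm
  have hdc : ∀ i, Continuous fun x => fderiv ℝ f x (EuclideanSpace.single i (1 : ℝ)) := fun i =>
    (hf.continuous_fderiv one_ne_zero).clm_apply continuous_const
  have hsum : ∫ x in Ω, fderiv ℝ f x v =
      ∑ i, v i * ∫ x in Ω, fderiv ℝ f x (EuclideanSpace.single i (1 : ℝ)) := by
    have : ∀ x, fderiv ℝ f x v = ∑ i, v i * fderiv ℝ f x (EuclideanSpace.single i (1 : ℝ)) := by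
      intro x
      conv_lhs => rw [hv]
      simp only [map_sum, map_smul, smul_eq_mul]
    simp_rw [this]
    rw [integral_finsetSum]
    · simp_rw [integral_const_mul]
    · exact fun i _ => (integrableOn_of_isBounded (hdc i) hb).const_mul _
  rw [hsum]
  calc ‖∑ i, v i * ∫ x in Ω, fderiv ℝ f x (EuclideanSpace.single i (1 : ℝ))‖ₑ
      ≤ ∑ i, ‖v i * ∫ x in Ω, fderiv ℝ f x (EuclideanSpace.single i (1 : ℝ))‖ₑ :=
        enorm_sum_le _ _
    _ ≤ ∑ _i : Fin (n + 1), ‖v‖ₑ * (2 * ∫⁻ x in frontier Ω, ‖f x‖ₑ ∂μHE[n]) := by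
        refine Finset.sum_le_sum fun i _ => ?_
        rw [enorm_mul]
        gcongr
        · exact enorm_le_iff_norm_le.2 (PiLp.norm_apply_le v i)
        · exact enorm_setIntegral_partial_le hΩ hb i hf
    _ = _ := by
        rw [Finset.sum_const, Finset.card_univ, Fintype.card_fin, nsmul_eq_mul,
          Nat.add_sub_cancel]
        ring

/-! ### Energy identities on the space-time cylinder -/

/-- One half of Tonelli's theorem for continuous functions, without σ-finiteness of the measure in
the first variable. -/
theorem lintegral_lintegral_le_swap_of_continuous {X : Type*} [TopologicalSpace X]
    [MeasurableSpace X] [OpensMeasurableSpace X] {μ : Measure X} {J : Set ℝ} (hJ : IsOpen J)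
    {f : X × ℝ → ℝ≥0∞} (hf : Measurable f) (hc : ∀ x, Continuous fun t => f (x, t)) :
    ∫⁻ t in J, ∫⁻ x, f (x, t) ∂μ ≤ ∫⁻ x, (∫⁻ t in J, f (x, t)) ∂μ := by
  let I : X → ℝ≥0∞ := fun x => ∫⁻ t in J, f (x, t)
  have hI : Measurable I := hf.lintegral_prod_right'
  by_cases htop : ∫⁻ x, I x ∂μ = ⊤
  · exact htop ▸ le_top
  have hint : Integrable (fun x => (I x).toReal) μ :=
    integrable_toReal_of_lintegral_ne_top hI.aemeasurable htop
  -- The surface measure of the frontier of a general bounded open set need not be σ-finite. A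
  -- finite integral of `I` forces `I = 0` almost everywhere off a σ-finite set `S`. There
  -- continuity makes `f (x, ·)` vanish at every `t ∈ J`, so for each fixed `t` only `S` matters.
  obtain ⟨S, hS, hS0, hσ⟩ := hint.aefinStronglyMeasurable.exists_set_sigmaFinite
  have hfin : ∀ᵐ x ∂μ.restrict Sᶜ, I x < ⊤ := ae_restrict_of_ae (ae_lt_top hI htop)
  have hzero : ∀ᵐ x ∂μ.restrict Sᶜ, ∀ t ∈ J, f (x, t) = 0 := by
    filter_upwards [hS0, hfin] with x hx hx'
    have hx0 : I x = 0 := ((ENNReal.toReal_eq_zero_iff _).1 hx).resolve_right hx'.ne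
    have hae := (lintegral_eq_zero_iff (hf.comp measurable_prodMk_left)).1 hx0
    intro t ht
    have := MeasureTheory.Measure.eqOn_open_of_ae_eq hae hJ (hc x).continuousOn continuousOn_const
    exact this ht
  calc ∫⁻ t in J, ∫⁻ x, f (x, t) ∂μ = ∫⁻ t in J, ∫⁻ x in S, f (x, t) ∂μ := by
        refine setLIntegral_congr_fun hJ.measurableSet fun t ht => ?_
        have h0 : ∫⁻ x in Sᶜ, f (x, t) ∂μ = 0 := by
          refine (lintegral_congr_ae ?_).trans lintegral_zero
          filter_upwards [hzero] with x hx using hx t ht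
        rw [← lintegral_add_compl _ hS, h0, add_zero]
    _ = ∫⁻ x in S, I x ∂μ := by
        rw [lintegral_lintegral_swap]
        exact (hf.comp measurable_swap).aemeasurable
    _ ≤ ∫⁻ x, I x ∂μ := setLIntegral_le_lintegral _ _

/-- For fixed `t` the field `H t` is constant in `x`, so the divergence inequality applies on each
time slice without a zero-order term. -/
theorem enorm_setIntegral_advection_le {d : ℕ} (hd : 1 ≤ d) {Ω : Set (EuclideanSpace ℝ (Fin d))}
    (hΩ : IsOpen Ω) (hb : Bornology.IsBounded Ω) {T M : ℝ} {H : ℝ → EuclideanSpace ℝ (Fin d)}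
    (hH : Continuous H) (hM : ∀ t, ‖H t‖ ≤ M)
    {F : EuclideanSpace ℝ (Fin d) × ℝ → ℝ} (hF : ContDiff ℝ 1 F) {a b : ℝ} (ha : 0 ≤ a)
    (hbT : b ≤ T) :
    ‖∫ z in Ω ×ˢ Ioo a b, fderiv ℝ F z (H z.2, 0)‖ₑ ≤
      2 * d * ENNReal.ofReal M * ∫⁻ z, ‖F z‖ₑ ∂(lateralMeasure Ω T) := by
  have hdc : Continuous fun z : EuclideanSpace ℝ (Fin d) × ℝ => fderiv ℝ F z (H z.2, 0) :=
    (hF.continuous_fderiv one_ne_zero).clm_apply (by fun_prop)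
  have hint : IntegrableOn (fun z : EuclideanSpace ℝ (Fin d) × ℝ => fderiv ℝ F z (H z.2, 0))
      (Ω ×ˢ Ioo a b) := integrableOn_of_isBounded hdc (hb.prod (Metric.isBounded_Ioo a b))
  have hslice : ∀ t x, fderiv ℝ F (x, t) (H t, 0) = fderiv ℝ (fun x => F (x, t)) x (H t) := by
    intro t x
    have h1 : HasFDerivAt (fun x : EuclideanSpace ℝ (Fin d) => (x, t))
        (ContinuousLinearMap.inl ℝ _ ℝ) x := hasFDerivAt_prodMk_left x t
    have h2 := ((hF.differentiable one_ne_zero (x, t)).hasFDerivAt).comp x h1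
    have h3 : fderiv ℝ (fun x => F (x, t)) x = _ := h2.fderiv
    rw [h3]; simp
  have hFc := hF.continuous
  rw [IntegrableOn, Measure.volume_eq_prod, ← Measure.prod_restrict] at hint
  rw [Measure.volume_eq_prod, ← Measure.prod_restrict, integral_prod_symm _ hint]
  calc _ ≤ ∫⁻ t in Ioo a b, ‖∫ x in Ω, fderiv ℝ F (x, t) (H t, 0)‖ₑ :=
        enorm_integral_le_lintegral_enorm _
    _ ≤ ∫⁻ t in Ioo a b, 2 * d * ENNReal.ofReal M *
          ∫⁻ x in frontier Ω, ‖F (x, t)‖ₑ ∂μHE[d - 1] := by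
        refine lintegral_mono fun t => ?_
        simp_rw [hslice]
        refine (enorm_setIntegral_fderiv_le hd hΩ hb
          (hF.comp (contDiff_id.prodMk contDiff_const)) (H t)).trans ?_
        refine mul_le_mul ?_ le_rfl zero_le zero_le
        gcongr
        rw [← ofReal_norm]
        exact ENNReal.ofReal_le_ofReal (hM t)
    _ = 2 * d * ENNReal.ofReal M *
          ∫⁻ t in Ioo a b, ∫⁻ x in frontier Ω, ‖F (x, t)‖ₑ ∂μHE[d - 1] :=
        lintegral_const_mul' _ _ (by finiteness)
    _ ≤ 2 * d * ENNReal.ofReal M *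
          ∫⁻ t in Ioo 0 T, ∫⁻ x in frontier Ω, ‖F (x, t)‖ₑ ∂μHE[d - 1] := by
        gcongr
    _ ≤ 2 * d * ENNReal.ofReal M *
          ∫⁻ x in frontier Ω, ∫⁻ t in Ioo 0 T, ‖F (x, t)‖ₑ ∂volume ∂μHE[d - 1] := by
        gcongr
        exact lintegral_lintegral_le_swap_of_continuous isOpen_Ioo hFc.enorm.measurable
          fun x => by fun_prop
    _ = _ := by
        rw [lateralMeasure, lintegral_prod _ hFc.enorm.measurable.aemeasurable]

theorem integral_sub_integral_eq_setIntegral_fderiv {d : ℕ} {Ω : Set (EuclideanSpace ℝ (Fin d))}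
    (hb : Bornology.IsBounded Ω) {F : EuclideanSpace ℝ (Fin d) × ℝ → ℝ} (hF : ContDiff ℝ 1 F)
    {a b : ℝ} (hab : a ≤ b) :
    (∫ x in Ω, F (x, b)) - ∫ x in Ω, F (x, a) = ∫ z in Ω ×ˢ Ioo a b, fderiv ℝ F z (0, 1) := by
  have hdc : Continuous fun z => fderiv ℝ F z (0, 1) :=
    (hF.continuous_fderiv one_ne_zero).clm_apply continuous_const
  have hFc := hF.continuous
  have hint : IntegrableOn (fun z => fderiv ℝ F z (0, 1)) (Ω ×ˢ Ioo a b) :=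
    integrableOn_of_isBounded hdc (hb.prod (Metric.isBounded_Ioo a b))
  rw [IntegrableOn, Measure.volume_eq_prod, ← Measure.prod_restrict] at hint
  rw [Measure.volume_eq_prod, ← Measure.prod_restrict, integral_prod _ hint, ← integral_sub
    (integrableOn_of_isBounded (by fun_prop) hb) (integrableOn_of_isBounded (by fun_prop) hb)]
  refine integral_congr_ae (Eventually.of_forall fun x => ?_)
  have hder : ∀ t, HasDerivAt (fun t => F (x, t)) (fderiv ℝ F (x, t) (0, 1)) t := fun t =>
    ((hF.differentiable one_ne_zero (x, t)).hasFDerivAt).comp_hasDerivAt t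
      ((hasDerivAt_const t x).prodMk (hasDerivAt_id t))
  change F (x, b) - F (x, a) = ∫ t in Ioo a b, fderiv ℝ F (x, t) (0, 1)
  rw [← integral_Ioc_eq_integral_Ioo, ← intervalIntegral.integral_of_le hab]
  exact (intervalIntegral.integral_eq_sub_of_hasDerivAt (fun t _ => hder t)
    ((hdc.comp (by fun_prop : Continuous fun t : ℝ => (x, t))).intervalIntegrable _ _)).symm

theorem ae_lateralMeasure_fst_mem_frontier {d : ℕ} (Ω : Set (EuclideanSpace ℝ (Fin d))) (T : ℝ) :
    ∀ᵐ z ∂(lateralMeasure Ω T), z.1 ∈ frontier Ω :=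
  Measure.quasiMeasurePreserving_fst.ae (ae_restrict_mem isClosed_frontier.measurableSet)

/-- The weighted energy identity for the transport operator, with the boundary term estimated. -/
theorem abs_weighted_energy_sub_le {d : ℕ} (hd : 1 ≤ d) {Ω : Set (EuclideanSpace ℝ (Fin d))}
    (hΩ : IsOpen Ω) (hb : Bornology.IsBounded Ω) {T M : ℝ} {H : ℝ → EuclideanSpace ℝ (Fin d)}
    (hH : Continuous H) (hM : ∀ t, ‖H t‖ ≤ M) {w : EuclideanSpace ℝ (Fin d) → ℝ}
    (hw : ContDiff ℝ 1 w) {W : ℝ} (hW : ∀ x ∈ closure Ω, |w x| ≤ W) (hW0 : 0 ≤ W)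
    {φ : EuclideanSpace ℝ (Fin d) × ℝ → ℝ} (hφ : ContDiff ℝ 1 φ)
    (hφi : Integrable (fun z => φ z ^ 2) (lateralMeasure Ω T)) {a b : ℝ} (ha : 0 ≤ a)
    (hab : a ≤ b) (hbT : b ≤ T) :
    |(∫ x in Ω, w x * φ (x, b) ^ 2) - (∫ x in Ω, w x * φ (x, a) ^ 2) -
        ∫ z in Ω ×ˢ Ioo a b, φ z ^ 2 * fderiv ℝ w z.1 (H z.2)| ≤
      W * (2 * d * M * ∫ z, φ z ^ 2 ∂(lateralMeasure Ω T) +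
        2 * ∫ z in cylinder Ω T, |φ z| * |fderiv ℝ φ z (H z.2, 1)|) := by
  have hM0 : 0 ≤ M := (norm_nonneg _).trans (hM 0)
  let F : EuclideanSpace ℝ (Fin d) × ℝ → ℝ := fun z => w z.1 * φ z ^ 2
  have hF : ContDiff ℝ 1 F := (hw.comp contDiff_fst).mul (hφ.pow 2)
  have hFder : ∀ z v, fderiv ℝ F z v =
      2 * w z.1 * φ z * fderiv ℝ φ z v + φ z ^ 2 * fderiv ℝ w z.1 v.1 := by
    intro z v
    have h1 : HasFDerivAt (fun z : EuclideanSpace ℝ (Fin d) × ℝ => w z.1)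
        ((fderiv ℝ w z.1).comp (ContinuousLinearMap.fst ℝ _ ℝ)) z :=
      ((hw.differentiable one_ne_zero z.1).hasFDerivAt).comp z hasFDerivAt_fst
    have h2 := ((hφ.differentiable one_ne_zero z).hasFDerivAt).pow 2
    have h3 : fderiv ℝ F z = _ := (h1.mul h2).fderiv
    rw [h3]
    simp
    ring
  have hφc := hφ.continuous
  have hdφ : Continuous fun z : EuclideanSpace ℝ (Fin d) × ℝ => fderiv ℝ φ z (H z.2, 1) :=
    (hφ.continuous_fderiv one_ne_zero).clm_apply (by fun_prop)
  have hdw : Continuous fun z : EuclideanSpace ℝ (Fin d) × ℝ => fderiv ℝ w z.1 (H z.2) :=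
    ((hw.continuous_fderiv one_ne_zero).comp continuous_fst).clm_apply (by fun_prop)
  have hwc := hw.continuous
  have hQb : Bornology.IsBounded (Ω ×ˢ Ioo a b) := hb.prod (Metric.isBounded_Ioo a b)
  have hsub : Ω ×ˢ Ioo a b ⊆ cylinder Ω T := prod_mono le_rfl (Ioo_subset_Ioo ha hbT)
  have hmeas : MeasurableSet (Ω ×ˢ Ioo a b) := hΩ.measurableSet.prod measurableSet_Ioo
  -- Uses `∂ₜF = (∂ₜ + H·∇)F - H·∇F` for `F = wφ²`. The first term splits into the residual part and
  -- `φ² H·∇w`; the last is bounded by the boundary integral.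
  have hsplit : ∫ z in Ω ×ˢ Ioo a b, fderiv ℝ F z (0, 1) =
      (∫ z in Ω ×ˢ Ioo a b, 2 * w z.1 * φ z * fderiv ℝ φ z (H z.2, 1)) +
      (∫ z in Ω ×ˢ Ioo a b, φ z ^ 2 * fderiv ℝ w z.1 (H z.2)) -
      ∫ z in Ω ×ˢ Ioo a b, fderiv ℝ F z (H z.2, 0) := by
    have hi1 : IntegrableOn (fun z : EuclideanSpace ℝ (Fin d) × ℝ =>
        2 * w z.1 * φ z * fderiv ℝ φ z (H z.2, 1)) (Ω ×ˢ Ioo a b) :=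
      integrableOn_of_isBounded (by fun_prop) hQb
    have hi2 : IntegrableOn (fun z : EuclideanSpace ℝ (Fin d) × ℝ =>
        φ z ^ 2 * fderiv ℝ w z.1 (H z.2)) (Ω ×ˢ Ioo a b) :=
      integrableOn_of_isBounded (by fun_prop) hQb
    have hi3 : IntegrableOn (fun z : EuclideanSpace ℝ (Fin d) × ℝ =>
        fderiv ℝ F z (H z.2, 0)) (Ω ×ˢ Ioo a b) :=
      integrableOn_of_isBounded
        ((hF.continuous_fderiv one_ne_zero).clm_apply (by fun_prop)) hQb
    rw [← integral_add hi1 hi2]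
    refine Eq.trans ?_ (integral_sub (hi1.add hi2) hi3)
    refine integral_congr_ae (Eventually.of_forall fun z => ?_)
    have hv : ((H z.2, 1) : EuclideanSpace ℝ (Fin d) × ℝ) = (H z.2, 0) + (0, 1) := by simp
    simp only [hFder, hv, map_add, map_zero, mul_zero, add_zero]
    ring
  have hB : |∫ z in Ω ×ˢ Ioo a b, fderiv ℝ F z (H z.2, 0)| ≤
      W * (2 * d * M * ∫ z, φ z ^ 2 ∂(lateralMeasure Ω T)) := by
    have hB0 : 0 ≤ ∫ z, φ z ^ 2 ∂(lateralMeasure Ω T) := integral_nonneg fun z => sq_nonneg _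
    rw [← Real.norm_eq_abs, ← ENNReal.ofReal_le_ofReal_iff (by positivity), ofReal_norm]
    refine (enorm_setIntegral_advection_le hd hΩ hb hH hM hF ha hbT).trans ?_
    have h1 : ∫⁻ z, ‖F z‖ₑ ∂(lateralMeasure Ω T) ≤
        ENNReal.ofReal W * ENNReal.ofReal (∫ z, φ z ^ 2 ∂(lateralMeasure Ω T)) := by
      rw [ofReal_integral_eq_lintegral_ofReal hφi (Eventually.of_forall fun z => sq_nonneg _),
        ← lintegral_const_mul' _ _ ENNReal.ofReal_ne_top]
      refine lintegral_mono_ae ?_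
      filter_upwards [ae_lateralMeasure_fst_mem_frontier Ω T] with z hz
      rw [← ENNReal.ofReal_mul hW0, ← ofReal_norm]
      refine ENNReal.ofReal_le_ofReal ?_
      rw [norm_mul, Real.norm_eq_abs, Real.norm_eq_abs, abs_of_nonneg (sq_nonneg (φ z))]
      exact mul_le_mul_of_nonneg_right (hW _ (frontier_subset_closure hz)) (sq_nonneg _)
    calc _ ≤ 2 * d * ENNReal.ofReal M *
          (ENNReal.ofReal W * ENNReal.ofReal (∫ z, φ z ^ 2 ∂(lateralMeasure Ω T))) := by gcongr
      _ = _ := by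
        rw [ENNReal.ofReal_mul hW0, ENNReal.ofReal_mul (by positivity),
          ENNReal.ofReal_mul (by positivity), ENNReal.ofReal_mul (by positivity),
          ENNReal.ofReal_natCast, ENNReal.ofReal_ofNat]
        ring
  have hR : |∫ z in Ω ×ˢ Ioo a b, 2 * w z.1 * φ z * fderiv ℝ φ z (H z.2, 1)| ≤
      W * (2 * ∫ z in cylinder Ω T, |φ z| * |fderiv ℝ φ z (H z.2, 1)|) := by
    have hi : IntegrableOn (fun z : EuclideanSpace ℝ (Fin d) × ℝ =>
        W * (2 * (|φ z| * |fderiv ℝ φ z (H z.2, 1)|))) (cylinder Ω T) :=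
      integrableOn_of_isBounded (by fun_prop) (hb.prod (Metric.isBounded_Ioo 0 T))
    rw [← integral_const_mul, ← integral_const_mul]
    refine le_trans ?_ (setIntegral_mono_set hi
      (Eventually.of_forall fun z => by simp only [Pi.zero_apply]; positivity) hsub.eventuallyLE)
    rw [← Real.norm_eq_abs]
    refine norm_integral_le_of_norm_le (hi.mono_set hsub) ?_
    filter_upwards [ae_restrict_mem hmeas] with z hz
    rw [norm_mul, norm_mul, norm_mul, Real.norm_ofNat, Real.norm_eq_abs, Real.norm_eq_abs,
      Real.norm_eq_abs]
    have := hW _ (subset_closure hz.1)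
    calc 2 * |w z.1| * |φ z| * |fderiv ℝ φ z (H z.2, 1)|
        ≤ 2 * W * |φ z| * |fderiv ℝ φ z (H z.2, 1)| := by gcongr
      _ = _ := by ring
  have hftc := integral_sub_integral_eq_setIntegral_fderiv hb hF hab
  simp only [F] at hftc
  rw [hftc, hsplit]
  calc _ = |(∫ z in Ω ×ˢ Ioo a b, 2 * w z.1 * φ z * fderiv ℝ φ z (H z.2, 1)) -
        ∫ z in Ω ×ˢ Ioo a b, fderiv ℝ F z (H z.2, 0)| := by congr 1; ring
    _ ≤ _ := (abs_sub _ _).trans (by rw [mul_add]; linarith)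

/-! ### Observability for smooth functions -/

/-- The observability estimate for functions which are smooth up to the boundary. -/
theorem exists_energy_le {d : ℕ} (hd : 1 ≤ d) {Ω : Set (EuclideanSpace ℝ (Fin d))}
    (hΩ : IsOpen Ω) (hb : Bornology.IsBounded Ω) {T M : ℝ} {H : ℝ → EuclideanSpace ℝ (Fin d)}
    (hH : Continuous H) (hM : ∀ t, ‖H t‖ ≤ M) {x₀ : EuclideanSpace ℝ (Fin d)} {m W δ τ : ℝ}
    (hm : ∀ x ∈ closure Ω, m ≤ ‖x - x₀‖ ^ 2) (hW : ∀ x ∈ closure Ω, ‖x - x₀‖ ^ 2 ≤ m + W)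
    (hW0 : 0 ≤ W) (hδ : ∀ x ∈ Ω, ∀ t ∈ Icc 0 τ, δ ≤ ⟪x - x₀, H t⟫) (hτ : 0 ≤ τ) (hτT : τ ≤ T)
    (hWδ : W < 2 * δ * τ) :
    ∃ C : ℝ, 0 < C ∧ ∀ φ : EuclideanSpace ℝ (Fin d) × ℝ → ℝ, ContDiff ℝ 1 φ →
      Integrable (fun z => φ z ^ 2) (lateralMeasure Ω T) → ∀ t ∈ Icc 0 T,
        ∫ x in Ω, φ (x, t) ^ 2 ≤ C * (∫ z, φ z ^ 2 ∂(lateralMeasure Ω T) +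
          ∫ z in cylinder Ω T, |φ z| * |fderiv ℝ φ z (H z.2, 1)|) := by
  have hM0 : 0 ≤ M := (norm_nonneg _).trans (hM 0)
  have hgap : 0 < 2 * δ * τ - W := sub_pos.2 hWδ
  have hsum : 0 < 2 * δ * τ + W := by linarith
  -- The quotient bounds `E τ` by `P`, the `+ 1` pays for moving from `τ` to `t`, and `2dM + 2`
  -- bounds `P` by `B + R`.
  refine ⟨((2 * δ * τ + W) / (2 * δ * τ - W) + 1) * (2 * d * M + 2), by positivity,
    fun φ hφ hφi t ht => ?_⟩
  set B := ∫ z, φ z ^ 2 ∂(lateralMeasure Ω T) with hB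
  set R := ∫ z in cylinder Ω T, |φ z| * |fderiv ℝ φ z (H z.2, 1)| with hR
  have hB0 : 0 ≤ B := integral_nonneg fun z => sq_nonneg _
  have hR0 : 0 ≤ R := integral_nonneg fun z => by positivity
  set P := 2 * d * M * B + 2 * R with hP
  have hP0 : 0 ≤ P := by positivity
  have hφc := hφ.continuous
  let E : ℝ → ℝ := fun s => ∫ x in Ω, φ (x, s) ^ 2
  -- Weight 1: the energy is conserved up to `P`.
  have henergy : ∀ a b, 0 ≤ a → a ≤ b → b ≤ T → |E b - E a| ≤ P := fun a b ha hab hbT => by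
    have h := abs_weighted_energy_sub_le hd hΩ hb hH hM (w := fun _ => 1) contDiff_const
      (W := 1) (fun x _ => by simp) zero_le_one hφ hφi ha hab hbT
    simpa [E] using h
  have hclose : ∀ a ∈ Icc 0 T, E a ≤ E τ + P ∧ E τ ≤ E a + P := fun a ha => by
    rcases le_total a τ with h | h
    · have := abs_le.1 (henergy a τ ha.1 h hτT); constructor <;> linarith
    · have := abs_le.1 (henergy τ a hτ h ha.2); constructor <;> linarith
  -- This weight lies between 0 and `W` on the closure and increases along the flow at rate at least
  -- `2δ` up to time `τ`.
  have hweight := abs_weighted_energy_sub_le hd hΩ hb hH hM (w := fun x => ‖x - x₀‖ ^ 2 - m)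
    (((contDiff_id.sub contDiff_const).norm_sq ℝ).sub contDiff_const) (W := W)
    (fun x hx => abs_le.2 ⟨by linarith [hm x hx], by linarith [hW x hx]⟩) hW0 hφ hφi le_rfl hτ hτT
  have hwder : ∀ x v, fderiv ℝ (fun x => ‖x - x₀‖ ^ 2 - m) x v = 2 * ⟪x - x₀, v⟫ := fun x v => by
    have h : HasFDerivAt (fun x => ‖x - x₀‖ ^ 2 - m) _ x :=
      (((hasFDerivAt_id x).sub_const x₀).norm_sq).sub_const m
    rw [h.fderiv]
    simp [inner_sub_left]
  simp only [hwder] at hweight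
  have hA0 : 0 ≤ ∫ x in Ω, (‖x - x₀‖ ^ 2 - m) * φ (x, 0) ^ 2 :=
    setIntegral_nonneg hΩ.measurableSet fun x hx =>
      mul_nonneg (by linarith [hm x (subset_closure hx)]) (sq_nonneg _)
  have hAτ : ∫ x in Ω, (‖x - x₀‖ ^ 2 - m) * φ (x, τ) ^ 2 ≤ W * E τ := by
    rw [← integral_const_mul]
    refine setIntegral_mono_on (integrableOn_of_isBounded (by fun_prop) hb)
      (integrableOn_of_isBounded (by fun_prop) hb) hΩ.measurableSet fun x hx => ?_
    exact mul_le_mul_of_nonneg_right (by linarith [hW x (subset_closure hx)]) (sq_nonneg _)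
  have hQb : Bornology.IsBounded (Ω ×ˢ Ioo 0 τ) := hb.prod (Metric.isBounded_Ioo 0 τ)
  have hδ0 : 0 < δ := by
    by_contra h
    nlinarith [mul_nonneg (neg_nonneg.2 (not_lt.1 h)) hτ]
  have hlow : 2 * δ * (τ * (E τ - P)) ≤
      ∫ z in Ω ×ˢ Ioo 0 τ, φ z ^ 2 * (2 * ⟪z.1 - x₀, H z.2⟫) := by
    have hi : IntegrableOn (fun z : EuclideanSpace ℝ (Fin d) × ℝ => φ z ^ 2) (Ω ×ˢ Ioo 0 τ) :=
      integrableOn_of_isBounded (by fun_prop) hQb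
    have h1 : ∫ z in Ω ×ˢ Ioo 0 τ, 2 * δ * φ z ^ 2 ≤
        ∫ z in Ω ×ˢ Ioo 0 τ, φ z ^ 2 * (2 * ⟪z.1 - x₀, H z.2⟫) :=
      setIntegral_mono_on (hi.const_mul _) (integrableOn_of_isBounded (by fun_prop) hQb)
        (hΩ.measurableSet.prod measurableSet_Ioo) fun z hz => by
          have := mul_le_mul_of_nonneg_left (hδ z.1 hz.1 z.2 (Ioo_subset_Icc_self hz.2))
            (sq_nonneg (φ z))
          linarith
    refine le_trans ?_ h1
    rw [integral_const_mul]
    refine mul_le_mul_of_nonneg_left ?_ (by positivity)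
    rw [IntegrableOn, Measure.volume_eq_prod, ← Measure.prod_restrict] at hi
    rw [Measure.volume_eq_prod, ← Measure.prod_restrict, integral_prod_symm _ hi]
    have hEi : IntegrableOn E (Ioo 0 τ) := hi.integral_prod_right
    calc τ * (E τ - P) = ∫ _ in Ioo 0 τ, (E τ - P) := by simp [hτ]
      _ ≤ ∫ s in Ioo 0 τ, E s := setIntegral_mono_on (by simp) hEi measurableSet_Ioo
          fun s hs => by linarith [(hclose s ⟨hs.1.le, hs.2.le.trans hτT⟩).2]
  have hup := (abs_le.1 hweight).1
  -- Combines `2δτ(E τ - P) ≤ ∫ φ² H·∇w ≤ W E τ + W P`, the weighted energy at time 0 being dropped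
  -- as nonnegative.
  have hfinal : (2 * δ * τ - W) * E τ ≤ (2 * δ * τ + W) * P := by nlinarith
  have hEτ : E τ ≤ (2 * δ * τ + W) / (2 * δ * τ - W) * P := by
    rw [div_mul_eq_mul_div, le_div_iff₀ hgap]; linarith
  have hPle : P ≤ (2 * d * M + 2) * (B + R) := by
    have : 0 ≤ 2 * d * M * R := by positivity
    rw [hP]; nlinarith
  calc E t ≤ E τ + P := (hclose t ht).1
    _ ≤ ((2 * δ * τ + W) / (2 * δ * τ - W) + 1) * P := by linarith
    _ ≤ ((2 * δ * τ + W) / (2 * δ * τ - W) + 1) * ((2 * d * M + 2) * (B + R)) := by gcongr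
    _ = _ := by ring

/-! ### Time slices and passage to `H¹` solutions -/

section L2

variable {X : Type*} [MeasurableSpace X] {μ : Measure X}

theorem eLpNorm_two_sq_eq_ofReal_integral {F : Type*} [NormedAddCommGroup F] {f : X → F}
    (hf : Integrable (fun x => ‖f x‖ ^ 2) μ) :
    eLpNorm f 2 μ ^ 2 = ENNReal.ofReal (∫ x, ‖f x‖ ^ 2 ∂μ) := by
  have h := eLpNorm_nnreal_pow_eq_lintegral (μ := μ) (f := f) (p := 2) two_ne_zero
  norm_num at h
  rw [h, ofReal_integral_eq_lintegral_ofReal hf (Eventually.of_forall fun x => sq_nonneg _)]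
  refine lintegral_congr fun x => ?_
  rw [ENNReal.ofReal_pow (norm_nonneg _), ofReal_norm]

theorem tendsto_eLpNorm_of_tendsto_eLpNorm_sub {F : Type*} [NormedAddCommGroup F]
    {f : ℕ → X → F} {g : X → F} (hf : ∀ n, AEStronglyMeasurable (f n) μ)
    (hg : AEStronglyMeasurable g μ)
    (h : Tendsto (fun n => eLpNorm (fun x => f n x - g x) 2 μ) atTop (𝓝 0)) :
    Tendsto (fun n => eLpNorm (f n) 2 μ) atTop (𝓝 (eLpNorm g 2 μ)) := by
  have hup : ∀ n, eLpNorm (f n) 2 μ ≤ eLpNorm g 2 μ + eLpNorm (fun x => f n x - g x) 2 μ :=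
    fun n => by
      have := eLpNorm_add_le hg ((hf n).sub hg) (p := 2) one_le_two
      simpa [add_sub_cancel] using! this
  have hlow : ∀ n, eLpNorm g 2 μ - eLpNorm (fun x => f n x - g x) 2 μ ≤ eLpNorm (f n) 2 μ :=
    fun n => by
      have := eLpNorm_sub_le (hf n) ((hf n).sub hg) (p := 2) one_le_two
      rw [tsub_le_iff_right]
      simpa [sub_sub_cancel] using! this
  refine tendsto_of_tendsto_of_tendsto_of_le_of_le ?_ ?_ hlow hup
  · simpa using ENNReal.Tendsto.sub (tendsto_const_nhds (x := eLpNorm g 2 μ)) h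
      (Or.inr ENNReal.zero_ne_top)
  · simpa using (tendsto_const_nhds (x := eLpNorm g 2 μ)).add h

end L2

variable {d : ℕ} {Ω : Set (EuclideanSpace ℝ (Fin d))} {T : ℝ}

/-- The trace inequality in time. The energies at two times differ by at most `∫ |∂ₜ(φ²)| ≤ ∫ φ² +
|Dφ|²`; averaging over the second time produces `1 / T`. -/
theorem energy_le_of_contDiff (hb : Bornology.IsBounded Ω) (hT : 0 < T)
    {φ : EuclideanSpace ℝ (Fin d) × ℝ → ℝ} (hφ : ContDiff ℝ 1 φ) {t : ℝ} (ht : t ∈ Icc 0 T) :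
    ∫ x in Ω, ‖φ (x, t)‖ ^ 2 ≤ (1 / T + 1) *
      ((∫ z in cylinder Ω T, ‖φ z‖ ^ 2) + ∫ z in cylinder Ω T, ‖fderiv ℝ φ z‖ ^ 2) := by
  have hφc := hφ.continuous
  have hdc := hφ.continuous_fderiv one_ne_zero
  have hQb : Bornology.IsBounded (cylinder Ω T) := hb.prod (Metric.isBounded_Ioo 0 T)
  let E : ℝ → ℝ := fun s => ∫ x in Ω, ‖φ (x, s)‖ ^ 2
  set A := ∫ z in cylinder Ω T, ‖φ z‖ ^ 2 with hA
  set B := ∫ z in cylinder Ω T, ‖fderiv ℝ φ z‖ ^ 2 with hB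
  have hA0 : 0 ≤ A := integral_nonneg fun z => sq_nonneg _
  have hB0 : 0 ≤ B := integral_nonneg fun z => sq_nonneg _
  have hinc : ∀ a b, 0 ≤ a → a ≤ b → b ≤ T → |E b - E a| ≤ A + B := fun a b ha hab hbT => by
    have hF : ContDiff ℝ 1 fun z => φ z ^ 2 := hφ.pow 2
    have h := integral_sub_integral_eq_setIntegral_fderiv hb hF hab
    have hi : IntegrableOn (fun z => ‖φ z‖ ^ 2 + ‖fderiv ℝ φ z‖ ^ 2) (cylinder Ω T) :=
      integrableOn_of_isBounded (by fun_prop) hQb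
    simp only [E, Real.norm_eq_abs, sq_abs]
    rw [h, hA, hB, ← integral_add (integrableOn_of_isBounded (by fun_prop) hQb)
      (integrableOn_of_isBounded (by fun_prop) hQb), ← Real.norm_eq_abs]
    have hsub : Ω ×ˢ Ioo a b ⊆ cylinder Ω T := prod_mono le_rfl (Ioo_subset_Ioo ha hbT)
    refine (norm_integral_le_of_norm_le (hi.mono_set hsub) (Eventually.of_forall fun z => ?_)).trans
      (setIntegral_mono_set hi (Eventually.of_forall fun z => by
        simp only [Pi.zero_apply]; positivity) hsub.eventuallyLE)
    have hder : fderiv ℝ (fun z => φ z ^ 2) z (0, 1) = 2 * φ z * fderiv ℝ φ z (0, 1) := by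
      have h2 := ((hφ.differentiable one_ne_zero z).hasFDerivAt).pow 2
      have h3 : fderiv ℝ (fun z => φ z ^ 2) z = _ := h2.fderiv
      rw [h3]
      simp
    have hop : ‖fderiv ℝ φ z (0, 1)‖ ≤ ‖fderiv ℝ φ z‖ := by
      have := (fderiv ℝ φ z).le_opNorm (0, 1)
      simpa [Prod.norm_def] using this
    rw [hder, norm_mul, norm_mul, Real.norm_ofNat]
    calc 2 * ‖φ z‖ * ‖fderiv ℝ φ z (0, 1)‖ ≤ 2 * ‖φ z‖ * ‖fderiv ℝ φ z‖ := by gcongr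
      _ ≤ _ := two_mul_le_add_sq _ _
  have hle : ∀ s ∈ Ioo 0 T, E t - (A + B) ≤ E s := fun s hs => by
    rcases le_total s t with h | h
    · linarith [(abs_le.1 (hinc s t hs.1.le h ht.2)).2]
    · linarith [(abs_le.1 (hinc t s ht.1 h hs.2.le)).1]
  have hi : IntegrableOn (fun z => ‖φ z‖ ^ 2) (cylinder Ω T) :=
    integrableOn_of_isBounded (by fun_prop) hQb
  have hAeq : A = ∫ s in Ioo 0 T, E s := by
    rw [cylinder, IntegrableOn, Measure.volume_eq_prod, ← Measure.prod_restrict] at hi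
    rw [hA, cylinder, Measure.volume_eq_prod, ← Measure.prod_restrict, integral_prod_symm _ hi]
  have hEi : IntegrableOn E (Ioo 0 T) := by
    rw [cylinder, IntegrableOn, Measure.volume_eq_prod, ← Measure.prod_restrict] at hi
    exact hi.integral_prod_right
  have hmain : T * (E t - (A + B)) ≤ A :=
    calc T * (E t - (A + B)) = ∫ _ in Ioo 0 T, (E t - (A + B)) := by simp [hT.le]
      _ ≤ ∫ s in Ioo 0 T, E s := setIntegral_mono_on (by simp) hEi measurableSet_Ioo hle
      _ = A := hAeq.symm
  have h1 : E t - (A + B) ≤ A / T := by rw [le_div_iff₀ hT]; linarith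
  have h2 : 0 ≤ B / T := by positivity
  change E t ≤ _
  calc E t ≤ A / T + (A + B) := by linarith
    _ ≤ A / T + B / T + (A + B) := by linarith
    _ = _ := by ring

theorem eLpNorm_slice_sq_le (hb : Bornology.IsBounded Ω) (hT : 0 < T)
    {φ : EuclideanSpace ℝ (Fin d) × ℝ → ℝ} (hφ : ContDiff ℝ 1 φ) {t : ℝ} (ht : t ∈ Icc 0 T) :
    eLpNorm (fun x => φ (x, t)) 2 (volume.restrict Ω) ^ 2 ≤ ENNReal.ofReal (1 / T + 1) *
      (eLpNorm φ 2 (volume.restrict (cylinder Ω T)) ^ 2 +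
        eLpNorm (fderiv ℝ φ) 2 (volume.restrict (cylinder Ω T)) ^ 2) := by
  have hφc := hφ.continuous
  have hdc := hφ.continuous_fderiv one_ne_zero
  have hQb : Bornology.IsBounded (cylinder Ω T) := hb.prod (Metric.isBounded_Ioo 0 T)
  rw [eLpNorm_two_sq_eq_ofReal_integral (integrableOn_of_isBounded (by fun_prop) hb),
    eLpNorm_two_sq_eq_ofReal_integral (integrableOn_of_isBounded (by fun_prop) hQb),
    eLpNorm_two_sq_eq_ofReal_integral (integrableOn_of_isBounded (by fun_prop) hQb),
    ← ENNReal.ofReal_add (integral_nonneg fun z => sq_nonneg _)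
      (integral_nonneg fun z => sq_nonneg _), ← ENNReal.ofReal_mul (by positivity)]
  exact ENNReal.ofReal_le_ofReal (energy_le_of_contDiff hb hT hφ ht)

/-- Each approximating sequence carries its own weak differential; uniqueness lets two such
sequences be compared. -/
theorem HasWeakDifferential.ae_eq {Q : Set (EuclideanSpace ℝ (Fin d) × ℝ)} (hQ : IsOpen Q)
    (hb : Bornology.IsBounded Q) {u : EuclideanSpace ℝ (Fin d) × ℝ → ℝ}
    {D D' : EuclideanSpace ℝ (Fin d) × ℝ → (EuclideanSpace ℝ (Fin d) × ℝ) →L[ℝ] ℝ}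
    (hD : HasWeakDifferential Q u D) (hD' : HasWeakDifferential Q u D') :
    D =ᵐ[volume.restrict Q] D' := by
  have : IsFiniteMeasure (volume.restrict Q) := ⟨by simpa using hb.measure_lt_top⟩
  have hmem : ∀ {D : EuclideanSpace ℝ (Fin d) × ℝ → (EuclideanSpace ℝ (Fin d) × ℝ) →L[ℝ] ℝ},
      MemLp D 2 (volume.restrict Q) → ∀ v, MemLp (fun z => D z v) 2 (volume.restrict Q) :=
    fun h v => (ContinuousLinearMap.apply ℝ ℝ v).comp_memLp' h
  have hdir : ∀ v, ∀ᵐ z ∂(volume.restrict Q), D z v = D' z v := by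
    intro v
    have hf := (hmem hD.1 v).sub (hmem hD'.1 v)
    have hloc : LocallyIntegrableOn ((fun z => D z v) - fun z => D' z v) Q (volume.restrict Q) :=
      (hf.integrable one_le_two).locallyIntegrable.locallyIntegrableOn Q
    have h := hQ.ae_eq_zero_of_integral_contDiff_smul_eq_zero hloc fun g hg hgc hgs => by
      have hg2 : MemLp g 2 (volume.restrict Q) := hg.continuous.memLp_of_hasCompactSupport hgc
      have h1 := hD.2 g hg hgc hgs v
      have h2 := hD'.2 g hg hgc hgs v
      have h3 : Integrable (fun z => D z v * g z) (volume.restrict Q) :=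
        (hmem hD.1 v).integrable_mul hg2
      have h4 : Integrable (fun z => D' z v * g z) (volume.restrict Q) :=
        (hmem hD'.1 v).integrable_mul hg2
      calc _ = ∫ z in Q, (D z v * g z - D' z v * g z) := by
            refine integral_congr_ae (Eventually.of_forall fun z => ?_)
            simp only [Pi.sub_apply, smul_eq_mul]
            ring
        _ = 0 := by rw [integral_sub h3 h4]; linarith
    filter_upwards [h, ae_restrict_mem hQ.measurableSet] with z hz hzQ
    exact sub_eq_zero.1 (hz hzQ)
  let b := Module.finBasis ℝ (EuclideanSpace ℝ (Fin d) × ℝ)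
  filter_upwards [ae_all_iff.2 fun i => hdir (b i)] with z hz
  exact ContinuousLinearMap.coe_injective (b.ext hz)

/-- The two indices are independent so that one statement serves twice: `φ = ψ` gives the Cauchy
property of the slices, and the diagonal gives independence of the approximating sequence. -/
theorem tendsto_eLpNorm_slice_sub (hΩ : IsOpen Ω) (hb : Bornology.IsBounded Ω) (hT : 0 < T)
    {u : EuclideanSpace ℝ (Fin d) × ℝ → ℝ} (hu : MemLp u 2 (volume.restrict (cylinder Ω T)))
    {φ ψ : ℕ → EuclideanSpace ℝ (Fin d) × ℝ → ℝ} (hφ : SmoothApproxH1 (cylinder Ω T) φ u)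
    (hψ : SmoothApproxH1 (cylinder Ω T) ψ u) {t : ℝ} (ht : t ∈ Icc 0 T) :
    Tendsto (fun p : ℕ × ℕ => eLpNorm (fun x => φ p.1 (x, t) - ψ p.2 (x, t)) 2
      (volume.restrict Ω)) atTop (𝓝 0) := by
  obtain ⟨hφs, hφ0, D, hD, hφ1⟩ := hφ
  obtain ⟨hψs, hψ0, D', hD', hψ1⟩ := hψ
  have hDD : D' =ᵐ[volume.restrict (cylinder Ω T)] D :=
    hD'.ae_eq (hΩ.prod isOpen_Ioo) (hb.prod (Metric.isBounded_Ioo 0 T)) hD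
  have hψ1' : Tendsto (fun n => eLpNorm (fun z => fderiv ℝ (ψ n) z - D z) 2
      (volume.restrict (cylinder Ω T))) atTop (𝓝 0) := by
    refine hψ1.congr fun n => eLpNorm_congr_ae ?_
    filter_upwards [hDD] with z hz
    rw [hz]
  have htri : ∀ {F : Type} [NormedAddCommGroup F] {f g h : EuclideanSpace ℝ (Fin d) × ℝ → F},
      AEStronglyMeasurable f (volume.restrict (cylinder Ω T)) →
      AEStronglyMeasurable g (volume.restrict (cylinder Ω T)) →
      AEStronglyMeasurable h (volume.restrict (cylinder Ω T)) →
      eLpNorm (fun z => f z - g z) 2 (volume.restrict (cylinder Ω T)) ≤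
        eLpNorm (fun z => f z - h z) 2 (volume.restrict (cylinder Ω T)) +
        eLpNorm (fun z => g z - h z) 2 (volume.restrict (cylinder Ω T)) := by
    intro F _ f g h hf hg hh
    have := eLpNorm_sub_le (hf.sub hh) (hg.sub hh) (p := 2) one_le_two
    simpa [sub_sub_sub_cancel_right] using! this
  have hbound : ∀ p : ℕ × ℕ, eLpNorm (fun x => φ p.1 (x, t) - ψ p.2 (x, t)) 2
      (volume.restrict Ω) ^ 2 ≤ ENNReal.ofReal (1 / T + 1) *
      ((eLpNorm (fun z => φ p.1 z - u z) 2 (volume.restrict (cylinder Ω T)) +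
        eLpNorm (fun z => ψ p.2 z - u z) 2 (volume.restrict (cylinder Ω T))) ^ 2 +
      (eLpNorm (fun z => fderiv ℝ (φ p.1) z - D z) 2 (volume.restrict (cylinder Ω T)) +
        eLpNorm (fun z => fderiv ℝ (ψ p.2) z - D z) 2 (volume.restrict (cylinder Ω T))) ^ 2) := by
    rintro ⟨n, k⟩
    have h1 : ContDiff ℝ 1 (φ n) := (hφs n).of_le (by exact_mod_cast le_top)
    have h2 : ContDiff ℝ 1 (ψ k) := (hψs k).of_le (by exact_mod_cast le_top)
    refine (eLpNorm_slice_sq_le hb hT (h1.sub h2) ht).trans ?_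
    gcongr
    · exact htri h1.continuous.aestronglyMeasurable h2.continuous.aestronglyMeasurable hu.1
    · have hfd : fderiv ℝ (φ n - ψ k) = fun z => fderiv ℝ (φ n) z - fderiv ℝ (ψ k) z := by
        ext1 z
        exact fderiv_sub (h1.differentiable one_ne_zero z) (h2.differentiable one_ne_zero z)
      have hfd' : (fderiv ℝ fun x => φ n x - ψ k x) =
          fun z => fderiv ℝ (φ n) z - fderiv ℝ (ψ k) z := hfd
      rw [hfd']
      exact htri (h1.continuous_fderiv one_ne_zero).aestronglyMeasurable
        (h2.continuous_fderiv one_ne_zero).aestronglyMeasurable hD.1.1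
  have hfst : Tendsto (Prod.fst : ℕ × ℕ → ℕ) atTop atTop := by
    rw [← prod_atTop_atTop_eq]; exact tendsto_fst
  have hsnd : Tendsto (Prod.snd : ℕ × ℕ → ℕ) atTop atTop := by
    rw [← prod_atTop_atTop_eq]; exact tendsto_snd
  have hlim : Tendsto (fun p : ℕ × ℕ => ENNReal.ofReal (1 / T + 1) *
      ((eLpNorm (fun z => φ p.1 z - u z) 2 (volume.restrict (cylinder Ω T)) +
        eLpNorm (fun z => ψ p.2 z - u z) 2 (volume.restrict (cylinder Ω T))) ^ 2 +
      (eLpNorm (fun z => fderiv ℝ (φ p.1) z - D z) 2 (volume.restrict (cylinder Ω T)) +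
        eLpNorm (fun z => fderiv ℝ (ψ p.2) z - D z) 2 (volume.restrict (cylinder Ω T))) ^ 2))
      atTop (𝓝 0) := by
    have h := ENNReal.Tendsto.const_mul (a := ENNReal.ofReal (1 / T + 1))
      ((ENNReal.Tendsto.pow (n := 2) ((hφ0.comp hfst).add (hψ0.comp hsnd))).add
        (ENNReal.Tendsto.pow (n := 2) ((hφ1.comp hfst).add (hψ1'.comp hsnd))))
      (Or.inr ENNReal.ofReal_ne_top)
    simpa using! h
  have hsq := tendsto_of_tendsto_of_tendsto_of_le_of_le tendsto_const_nhds hlim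
    (fun _ => zero_le) hbound
  have hroot := (ENNReal.continuous_rpow_const (y := 1 / 2)).tendsto 0 |>.comp hsq
  rw [ENNReal.zero_rpow_of_pos (by norm_num)] at hroot
  refine hroot.congr fun p => ?_
  simp only [Function.comp_apply]
  rw [← ENNReal.rpow_natCast, ← ENNReal.rpow_mul]
  norm_num

theorem exists_hasTimeSlice (hΩ : IsOpen Ω) (hb : Bornology.IsBounded Ω) (hT : 0 < T)
    {u : EuclideanSpace ℝ (Fin d) × ℝ → ℝ} (hu : MemLp u 2 (volume.restrict (cylinder Ω T)))
    {φ : ℕ → EuclideanSpace ℝ (Fin d) × ℝ → ℝ} (hφ : SmoothApproxH1 (cylinder Ω T) φ u)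
    {t : ℝ} (ht : t ∈ Icc 0 T) : ∃ w, HasTimeSlice Ω T u t w := by
  have : IsFiniteMeasure (volume.restrict Ω) := ⟨by simpa using hb.measure_lt_top⟩
  have hmem : ∀ n, MemLp (fun x => φ n (x, t)) 2 (volume.restrict Ω) := fun n => by
    have hc := (hφ.1 n).continuous
    exact (memLp_two_iff_integrable_sq (by fun_prop)).2
      (integrableOn_of_isBounded (by fun_prop) hb)
  have hcau : CauchySeq fun n => (hmem n).toLp := by
    rw [EMetric.cauchySeq_iff]
    intro ε hε
    have h := (tendsto_eLpNorm_slice_sub hΩ hb hT hu hφ hφ ht).eventually (gt_mem_nhds hε)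
    obtain ⟨N, hN⟩ := eventually_atTop_prod_self.1 h
    exact ⟨N, fun m hm n hn => by rw [Lp.edist_toLp_toLp]; exact hN m n hm hn⟩
  obtain ⟨w, hw⟩ := cauchySeq_tendsto_of_complete hcau
  refine ⟨w, Lp.memLp w, φ, hφ, ?_⟩
  rw [← Lp.toLp_coeFn w (Lp.memLp w), Lp.tendsto_Lp_iff_tendsto_eLpNorm''] at hw
  exact hw

/-- The lateral trace and the time slice may be realized by different sequences. This makes a single
sequence, the one for the lateral trace, serve both. -/
theorem tendsto_eLpNorm_sub_timeSlice (hΩ : IsOpen Ω) (hb : Bornology.IsBounded Ω) (hT : 0 < T)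
    {u : EuclideanSpace ℝ (Fin d) × ℝ → ℝ} (hu : MemLp u 2 (volume.restrict (cylinder Ω T)))
    {φ : ℕ → EuclideanSpace ℝ (Fin d) × ℝ → ℝ} (hφ : SmoothApproxH1 (cylinder Ω T) φ u)
    {t : ℝ} (ht : t ∈ Icc 0 T) {w : EuclideanSpace ℝ (Fin d) → ℝ} (hw : HasTimeSlice Ω T u t w) :
    Tendsto (fun n => eLpNorm (fun x => φ n (x, t) - w x) 2 (volume.restrict Ω)) atTop (𝓝 0) := by
  obtain ⟨hwm, ψ, hψ, hψw⟩ := hw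
  have hdiag : Tendsto (fun n : ℕ => (n, n)) atTop atTop := by
    rw [← prod_atTop_atTop_eq]; exact tendsto_id.prodMk tendsto_id
  have h := ((tendsto_eLpNorm_slice_sub hΩ hb hT hu hφ hψ ht).comp hdiag).add hψw
  rw [add_zero] at h
  refine tendsto_of_tendsto_of_tendsto_of_le_of_le tendsto_const_nhds h (fun _ => zero_le)
    fun n => ?_
  have hc := (hφ.1 n).continuous
  have hc' := (hψ.1 n).continuous
  have h1 : AEStronglyMeasurable (fun x => φ n (x, t) - ψ n (x, t)) (volume.restrict Ω) := by
    fun_prop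
  have h2 : AEStronglyMeasurable (fun x => ψ n (x, t) - w x) (volume.restrict Ω) :=
    (by fun_prop : AEStronglyMeasurable (fun x => ψ n (x, t)) (volume.restrict Ω)).sub hwm.1
  have := eLpNorm_add_le h1 h2 (p := 2) one_le_two
  refine le_of_eq_of_le (congrArg (eLpNorm · 2 _) ?_) this
  ext x
  simp

/-- An estimate for smooth functions passes to `H¹` solutions of the transport equation. -/
theorem eLpNorm_timeSlice_le (hΩ : IsOpen Ω) (hb : Bornology.IsBounded Ω) (hT : 0 < T)
    {H : ℝ → EuclideanSpace ℝ (Fin d)} {M C : ℝ} (hH : Continuous H) (hM : ∀ t, ‖H t‖ ≤ M)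
    (hC : 0 < C)
    (hest : ∀ φ : EuclideanSpace ℝ (Fin d) × ℝ → ℝ, ContDiff ℝ 1 φ →
      Integrable (fun z => φ z ^ 2) (lateralMeasure Ω T) → ∀ t ∈ Icc 0 T,
        ∫ x in Ω, φ (x, t) ^ 2 ≤ C * (∫ z, φ z ^ 2 ∂(lateralMeasure Ω T) +
          ∫ z in cylinder Ω T, |φ z| * |fderiv ℝ φ z (H z.2, 1)|))
    {g u : EuclideanSpace ℝ (Fin d) × ℝ → ℝ} (hu : IsSolution Ω T H g u) {t : ℝ}
    (ht : t ∈ Icc 0 T) {w : EuclideanSpace ℝ (Fin d) → ℝ} (hw : HasTimeSlice Ω T u t w) :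
    eLpNorm w 2 (volume.restrict Ω) ≤
      ENNReal.ofReal (√C) * eLpNorm g 2 (lateralMeasure Ω T) := by
  obtain ⟨hg, φ, hφ, hφg⟩ := hu.boundary
  have hslice := tendsto_eLpNorm_sub_timeSlice hΩ hb hT hu.memH1.1 hφ ht hw
  obtain ⟨hφs, hφ0, D, hD, hφ1⟩ := hφ
  have hφ' : ∀ n, ContDiff ℝ 1 (φ n) := fun n => (hφs n).of_le (by exact_mod_cast le_top)
  have hφc : ∀ n, Continuous (φ n) := fun n => (hφ' n).continuous
  have hLc : ∀ n, Continuous fun z : EuclideanSpace ℝ (Fin d) × ℝ =>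
      fderiv ℝ (φ n) z (H z.2, 1) := fun n =>
    ((hφ' n).continuous_fderiv one_ne_zero).clm_apply (by fun_prop)
  have hQb : Bornology.IsBounded (cylinder Ω T) := hb.prod (Metric.isBounded_Ioo 0 T)
  let S := fun n => eLpNorm (fun x => φ n (x, t)) 2 (volume.restrict Ω)
  let B := fun n => eLpNorm (φ n) 2 (lateralMeasure Ω T)
  let P := fun n => eLpNorm (φ n) 2 (volume.restrict (cylinder Ω T))
  let L := fun n => eLpNorm (fun z : EuclideanSpace ℝ (Fin d) × ℝ => fderiv ℝ (φ n) z (H z.2, 1)) 2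
    (volume.restrict (cylinder Ω T))
  have hS : Tendsto S atTop (𝓝 (eLpNorm w 2 (volume.restrict Ω))) :=
    tendsto_eLpNorm_of_tendsto_eLpNorm_sub
      (fun n => ((hφc n).comp (by fun_prop : Continuous fun x => (x, t))).aestronglyMeasurable)
      hw.1.1 hslice
  have hB : Tendsto B atTop (𝓝 (eLpNorm g 2 (lateralMeasure Ω T))) :=
    tendsto_eLpNorm_of_tendsto_eLpNorm_sub (fun n => (hφc n).aestronglyMeasurable) hg.1 hφg
  have hP : Tendsto P atTop (𝓝 (eLpNorm u 2 (volume.restrict (cylinder Ω T)))) :=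
    tendsto_eLpNorm_of_tendsto_eLpNorm_sub (fun n => (hφc n).aestronglyMeasurable) hu.memH1.1.1 hφ0
  -- `D` annihilates `(H, 1)` almost everywhere, so the residual of `φ n` is `(Dφₙ - D)(H, 1)`; `max
  -- M 1` bounds the sup norm of `(H, 1)`.
  have hL : Tendsto L atTop (𝓝 0) := by
    have hle : ∀ n, L n ≤ ENNReal.ofReal (max M 1) *
        eLpNorm (fun z => fderiv ℝ (φ n) z - D z) 2 (volume.restrict (cylinder Ω T)) := fun n => by
      refine eLpNorm_le_mul_eLpNorm_of_ae_le_mul ?_ 2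
      filter_upwards [hu.equation D hD] with z hz
      have hD0 : D z (H z.2, 1) = 0 := by
        have hv : ((H z.2, 1) : EuclideanSpace ℝ (Fin d) × ℝ) = (0, 1) + (H z.2, 0) := by simp
        rw [hv, map_add, hz]
      have heq : fderiv ℝ (φ n) z (H z.2, 1) = (fderiv ℝ (φ n) z - D z) (H z.2, 1) := by
        rw [sub_apply, hD0, sub_zero]
      rw [heq, mul_comm]
      refine (ContinuousLinearMap.le_opNorm _ _).trans ?_
      gcongr
      rw [Prod.norm_def, norm_one]
      exact max_le_max_right _ (hM _)
    refine tendsto_of_tendsto_of_tendsto_of_le_of_le tendsto_const_nhds ?_ (fun _ => zero_le) hle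
    have h := ENNReal.Tendsto.const_mul (a := ENNReal.ofReal (max M 1)) hφ1
      (Or.inr ENNReal.ofReal_ne_top)
    rwa [mul_zero] at h
  have hbound : ∀ n, S n ^ 2 ≤ ENNReal.ofReal C * (B n ^ 2 + P n * L n) := fun n => by
    -- The surface measure is not known to be finite here, so `φ n` may fail to be in `L²(Σ)`; the
    -- bound is then trivial.
    by_cases hBn : B n = ⊤
    · rw [hBn, ENNReal.top_pow two_ne_zero, top_add, ENNReal.mul_top (by simpa using hC)]
      exact le_top
    have hBi : Integrable (fun z => φ n z ^ 2) (lateralMeasure Ω T) :=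
      (memLp_two_iff_integrable_sq (hφc n).aestronglyMeasurable).1
        ⟨(hφc n).aestronglyMeasurable, lt_top_iff_ne_top.2 hBn⟩
    have hφn := hφc n
    have hS2 : S n ^ 2 = ENNReal.ofReal (∫ x in Ω, φ n (x, t) ^ 2) := by
      have h := eLpNorm_two_sq_eq_ofReal_integral (μ := volume.restrict Ω)
        (f := fun x => φ n (x, t)) (integrableOn_of_isBounded (by fun_prop) hb)
      simpa using h
    have hB2 : B n ^ 2 = ENNReal.ofReal (∫ z, φ n z ^ 2 ∂(lateralMeasure Ω T)) := by
      have h := eLpNorm_two_sq_eq_ofReal_integral (μ := lateralMeasure Ω T) (f := φ n)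
        (by simpa using hBi)
      simpa using h
    have hPL : ENNReal.ofReal (∫ z in cylinder Ω T, |φ n z| * |fderiv ℝ (φ n) z (H z.2, 1)|) ≤
        P n * L n := by
      have hLn := hLc n
      have h := eLpNorm_smul_le_mul_eLpNorm (p := 2) (q := 2) (r := 1)
        (hLc n).aestronglyMeasurable (hφc n).aestronglyMeasurable
        (μ := volume.restrict (cylinder Ω T))
      refine le_trans (le_of_eq ?_) h
      rw [eLpNorm_one_eq_lintegral_enorm, ofReal_integral_eq_lintegral_ofReal
        (integrableOn_of_isBounded (by fun_prop) hQb) (Eventually.of_forall fun z => by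
          simp only [Pi.zero_apply]; positivity)]
      refine lintegral_congr fun z => ?_
      rw [← ofReal_norm, ← abs_mul]
      rfl
    rw [hS2, hB2]
    refine (ENNReal.ofReal_le_ofReal (hest (φ n) (hφ' n) hBi t ht)).trans ?_
    rw [ENNReal.ofReal_mul hC.le, ENNReal.ofReal_add (integral_nonneg fun z => sq_nonneg _)
      (integral_nonneg fun z => by positivity)]
    gcongr
  have hlim := le_of_tendsto_of_tendsto' (ENNReal.Tendsto.pow (n := 2) hS)
    (ENNReal.Tendsto.const_mul ((ENNReal.Tendsto.pow (n := 2) hB).add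
      (ENNReal.Tendsto.mul hP (Or.inr ENNReal.zero_ne_top) hL
        (Or.inr hu.memH1.1.2.ne))) (Or.inr ENNReal.ofReal_ne_top)) hbound
  rw [mul_zero, add_zero, ← Real.sq_sqrt hC.le, ENNReal.ofReal_pow (Real.sqrt_nonneg C),
    ← mul_pow] at hlim
  exact (ENNReal.pow_le_pow_left_iff two_ne_zero).1 hlim

end Transport

/-! ### Assembly of the main theorem -/

/-- For arbitrary `H` the set may be empty, with `sSup` equal to 0; this is where `0 ≤ T₁` enters.
-/
theorem Transport.angleTime_le {d : ℕ} (H : ℝ → EuclideanSpace ℝ (Fin d)) (c₀ : ℝ) {T₁ : ℝ}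
    (hT₁ : 0 ≤ T₁) : angleTime H c₀ T₁ ≤ T₁ :=
  Real.sSup_le (fun _ hτ => hτ.1.2) hT₁

theorem mainTheorem2 (d : ℕ) (hd : 1 ≤ d) (Ω : Set (EuclideanSpace ℝ (Fin d)))
    (hΩ : Transport.IsSmoothBoundedDomain Ω)
    (T : ℝ) (hT : 0 < T) (c₀ : ℝ) (hc₀ : c₀ ∈ Ioo (1 / Real.sqrt 2) 1)
    (H : ℝ → EuclideanSpace ℝ (Fin d)) (hH : ContinuousOn H (Icc 0 T))
    (T₁ : ℝ) (hT₁ : T₁ ∈ Ioc 0 T) (ρ : ℝ) (hρ : 0 < ρ)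
    (hHρ : ∀ t ∈ Icc 0 T₁, ρ ≤ ‖H t‖)
    (hH1 : ContDiffOn ℝ 1 H (Icc 0 T₁))
    (x₀ : EuclideanSpace ℝ (Fin d)) (hx₀ : x₀ ∈ (closure Ω)ᶜ)
    (hangle : ∀ x ∈ closure Ω, ∀ t ∈ Icc 0 (Transport.angleTime H c₀ T₁),
      2 * c₀ ^ 2 - 1 ≤ ⟪H t, x - x₀⟫ / (‖H t‖ * ‖x - x₀‖))
    (htime : Transport.observationTime Ω ρ c₀ x₀ < Transport.angleTime H c₀ T₁) :
    ∃ C : ℝ, 0 < C ∧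
      ∀ g : EuclideanSpace ℝ (Fin d) × ℝ → ℝ, MemLp g 2 (Transport.lateralMeasure Ω T) →
      ∀ u : EuclideanSpace ℝ (Fin d) × ℝ → ℝ, Transport.IsSolution Ω T H g u →
      ∀ t ∈ Icc 0 T,
        (∃ w, Transport.HasTimeSlice Ω T u t w) ∧
        ∀ w, Transport.HasTimeSlice Ω T u t w →
          eLpNorm w 2 (volume.restrict Ω) ≤
            ENNReal.ofReal C * eLpNorm g 2 (Transport.lateralMeasure Ω T) := by
  have hb := hΩ.isBounded
  have hne : Ω.Nonempty := hΩ.isConnected.nonempty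
  have hKc : IsCompact (closure Ω) := hb.isCompact_closure
  set τ := Transport.angleTime H c₀ T₁ with hτdef
  have hτT₁ : τ ≤ T₁ := Transport.angleTime_le H c₀ hT₁.1.le
  have hτT : τ ≤ T := hτT₁.trans hT₁.2
  have hκ : 0 < 2 * c₀ ^ 2 - 1 := by
    have h1 : (1 / √2) ^ 2 < c₀ ^ 2 := pow_lt_pow_left₀ hc₀.1 (by positivity) two_ne_zero
    rw [div_pow, Real.sq_sqrt zero_le_two] at h1
    linarith
  have hr : 0 < Metric.infDist x₀ Ω := (Metric.infDist_pos_iff_notMem_closure hne).1 hx₀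
  have hδ : 0 < Transport.deltaConst Ω ρ c₀ x₀ := mul_pos (mul_pos hρ hκ) hr
  have hdist : ∀ x ∈ closure Ω, Metric.infDist x₀ Ω ≤ ‖x - x₀‖ := fun x hx => by
    rw [← Metric.infDist_closure, ← dist_eq_norm, dist_comm]
    exact Metric.infDist_le_dist_of_mem hx
  have himg : IsCompact ((fun x => ‖x - x₀‖ ^ 2) '' closure Ω) := hKc.image (by fun_prop)
  set m := sInf ((fun x => ‖x - x₀‖ ^ 2) '' closure Ω) with hmdef
  set S := sSup ((fun x => ‖x - x₀‖ ^ 2) '' closure Ω) with hSdef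
  have hm : ∀ x ∈ closure Ω, m ≤ ‖x - x₀‖ ^ 2 := fun x hx =>
    csInf_le himg.bddBelow (mem_image_of_mem _ hx)
  have hS : ∀ x ∈ closure Ω, ‖x - x₀‖ ^ 2 ≤ S := fun x hx =>
    le_csSup himg.bddAbove (mem_image_of_mem _ hx)
  have hW0 : 0 ≤ S - m := by
    obtain ⟨x, hx⟩ := hne
    linarith [hm x (subset_closure hx), hS x (subset_closure hx)]
  have hobs : Transport.observationTime Ω ρ c₀ x₀ =
    (S - m) / Transport.deltaConst Ω ρ c₀ x₀ := rfl
  rw [hobs] at htime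
  have hτ : 0 < τ := (div_nonneg hW0 hδ.le).trans_lt htime
  -- The time hypothesis gives `S - m < δτ`, so a factor 2 is to spare.
  have hWδ : S - m < 2 * Transport.deltaConst Ω ρ c₀ x₀ * τ := by
    rw [div_lt_iff₀ hδ] at htime
    linarith [mul_pos hτ hδ]
  -- `H` is extended continuously to the whole line
  let Hc : ℝ → EuclideanSpace ℝ (Fin d) := IccExtend hT.le ((Icc 0 T).domRestrict H)
  have hHc : Continuous Hc := (continuousOn_iff_continuous_domRestrict.1 hH).Icc_extend'
  have hHc_eq : ∀ t ∈ Icc 0 T, Hc t = H t := fun t ht => IccExtend_of_mem hT.le _ ht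
  obtain ⟨M, hM⟩ := (isCompact_Icc.image_of_continuousOn hH).isBounded.exists_norm_le
  have hHcM : ∀ t, ‖Hc t‖ ≤ M := fun t => hM _ ⟨_, (projIcc 0 T hT.le t).2, rfl⟩
  -- The angle condition bounds the cosine below by `2c₀² - 1`, while `|H| ≥ ρ` and `|x - x₀| ≥
  -- dist(x₀, Ω)`; the product of the three bounds is `δ`.
  have hlow : ∀ x ∈ Ω, ∀ t ∈ Icc 0 τ, Transport.deltaConst Ω ρ c₀ x₀ ≤ ⟪x - x₀, Hc t⟫ := by
    intro x hx t ht
    have hxc := subset_closure hx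
    rw [hHc_eq t ⟨ht.1, ht.2.trans hτT⟩, real_inner_comm]
    have hHt := hHρ t ⟨ht.1, ht.2.trans hτT₁⟩
    have hd' := hdist x hxc
    have hpos : 0 < ‖H t‖ * ‖x - x₀‖ := mul_pos (hρ.trans_le hHt) (hr.trans_le hd')
    have h := (le_div_iff₀ hpos).1 (hangle x hxc t ht)
    calc Transport.deltaConst Ω ρ c₀ x₀
        = (2 * c₀ ^ 2 - 1) * (ρ * Metric.infDist x₀ Ω) := by rw [Transport.deltaConst]; ring
      _ ≤ (2 * c₀ ^ 2 - 1) * (‖H t‖ * ‖x - x₀‖) := by gcongr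
      _ ≤ _ := h
  obtain ⟨C, hC, hest⟩ := Transport.exists_energy_le hd hΩ.isOpen hb hHc hHcM hm
    (W := S - m) (fun x hx => by linarith [hS x hx]) hW0 hlow hτ.le hτT hWδ
  refine ⟨√C, Real.sqrt_pos.2 hC, fun g hg u hu t ht => ?_⟩
  have hu' : Transport.IsSolution Ω T Hc g u := by
    refine ⟨hu.memH1, fun D hD => ?_, hu.boundary⟩
    filter_upwards [hu.equation D hD,
      ae_restrict_mem (hΩ.isOpen.measurableSet.prod measurableSet_Ioo)] with z hz hzQ
    rwa [hHc_eq z.2 (Ioo_subset_Icc_self hzQ.2)]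
  obtain ⟨_, φ, hφ, _⟩ := hu.boundary
  exact ⟨Transport.exists_hasTimeSlice hΩ.isOpen hb hT hu.memH1.1 hφ ht, fun w hw =>
    Transport.eLpNorm_timeSlice_le hΩ.isOpen hb hT hHc hHcM hC hest hu' ht hw⟩
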